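/- Let $b=(b_k)_{k\ge1}\in\ell^2(\mathbb R)$ with $b_k\neq0$ for all $k$, and let $\omega=(\omega_k)_{k\ge1}$ be real numbers with $\omega_1>0$ and $\omega_{k+1}-\omega_k\ge\omega_*>0$ for all $k\ge1$. On the Hilbert space $H=\ell^2(\mathbb R)\times\ell^2(\mathbb R)$ consider the system of controlled oscillators $$\dot\xi_k=\omega_k\eta_k,\qquad \dot\eta_k=-\omega_k\xi_k+b_ku(t),\qquad k\ge1,$$ written as $\dot x=Ax+Bu$ with $x=(\xi,\eta)$, $A(\xi,\eta)=(\Omega\eta,-\Omega\xi)$, $\Omega=\mathrm{diag}(\omega_1,\omega_2,\dots)$, $B=(0,b)$. Here $A$ generates a unitary group $(e^{tA})_{t\in\mathbb R}$ on $H$, and the solution with initial state $x^0\in H$ and scalar control $u\in L^2(0,T)$ is $x(t)=e^{tA}x^0+\int_0^te^{(t-s)A}Bu(s)\,ds$. Let $\mathcal R_T(x^0)=\{x(T): u\in L^2(0,T)\}$ be the reachable set, and let $$V_{0,1}=\Big\{(\xi,\eta):\ \sum_{k\ge1}\frac{\xi_k^2+\eta_k^2}{|b_k|^2}<\infty\Big\}\subset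 H,\qquad \big\langle(\xi,\eta),(\tilde\xi,\tilde\eta)\big\rangle_{V_{0,1}}=\sum_{k\ge1}\frac{\xi_k\tilde\xi_k+\eta_k\tilde\eta_k}{|b_k|^2}.$$ The system is called exactly controllable in time $T$ in a linear subspace $W\subset H$ if for all $x^0,x^1\in W$ there is $u\in L^2(0,T)$ such that the solution with $x(0)=x^0$ satisfies $x(T)=x^1$. A Hilbert subspace of $H$ is a linear subspace of $H$ endowed with an inner product for which it is a Hilbert space continuously embedded in $H$. Let $T>2\pi/\omega_*$. Then: 1. $V_{0,1}$, with the inner product above, is a Hilbert subspace of $H$, and the system is exactly controllable in time $T$ in $V_{0,1}$. 2. $\mathcal R_T(x^0)=V_{0,1}$ for every $x^0\in V_{0,1}$. 3. $V_{0,1}$ is the largest Hilbert subspace of $H$ in which the system is exactly controllable in time $T$: every such Hilbert subspace is contained in $V_{0,1}$. 4. The system is well posed in $V_{0,1}$: for every $\tau>0$ there is a constant $C$ such that, for all $x^0\in V_{0,1}$ and $u\in L^2(0,\tau)$, the solution $x$ with $x(0)=x^0$ satisfies $x(t)\in V_{0,1}$ for all $t\in[0,\tau]$, $x\in C^0([0,\tau];V_{0,1})$,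 and $\|x(t)\|_{V_{0,1}}\le C\big(\|x^0\|_{V_{0,1}}+\|u\|_{L^2(0,\tau)}\big)$ for all $t\in[0,\tau]$. -/

import Mathlib

open MeasureTheory Filter Topology Set

namespace Oscillator

/-- The real Hilbert space `ℓ²(ℝ)`, indexed by `ℕ = {0, 1, 2, …}`. -/
abbrev EllTwo : Type := lp (fun _ : ℕ => ℝ) 2

/-- The state space `H = ℓ²(ℝ) × ℓ²(ℝ)` with its Hilbert norm; a state is `x = (ξ, η)`,
with `ξ = x.fst` and `η = x.snd`. -/
abbrev State : Type := WithLp 2 (EllTwo × EllTwo)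

theorem summable_sq (ξ : EllTwo) : Summable fun k => ξ k ^ 2 := by
  simpa using lp.memℓp ξ |>.summable (by norm_num)

theorem memℓp_two_of_sq_le {f g : ℕ → ℝ} (hg : Summable g) (hfg : ∀ k, f k ^ 2 ≤ g k) :
    Memℓp f 2 := by
  refine memℓp_gen ?_
  simpa using Summable.of_nonneg_of_le (fun k => sq_nonneg (f k)) hfg hg

theorem memℓp_rot (c s : ℕ → ℝ) (hcs : ∀ k, c k ^ 2 + s k ^ 2 = 1) (ξ η : EllTwo) :
    Memℓp (fun k => c k * ξ k + s k * η k) 2 :=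
  memℓp_two_of_sq_le ((summable_sq ξ).add (summable_sq η)) fun k => by
    nlinarith [sq_nonneg (s k * ξ k - c k * η k), hcs k,
      congrArg (fun z => z * (ξ k ^ 2 + η k ^ 2)) (hcs k)]

/-- The graph of the operator `A = [[0, Ω], [-Ω, 0]]`, `Ω = diag(ω₀, ω₁, …)`, on its domain
`D(A) = {x ∈ H | A x ∈ H}`. -/
def GenGraph (ω : ℕ → ℝ) (x y : State) : Prop :=
  ∀ k, y.fst k = ω k * x.snd k ∧ y.snd k = -ω k * x.fst k

/-- The unitary group `e^{tA}`: a rotation in every mode. -/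
noncomputable def flow (ω : ℕ → ℝ) (t : ℝ) (x : State) : State :=
  WithLp.toLp 2
    (⟨fun k => Real.cos (ω k * t) * x.fst k + Real.sin (ω k * t) * x.snd k,
      memℓp_rot _ _ (fun k => Real.cos_sq_add_sin_sq (ω k * t)) x.fst x.snd⟩,
     ⟨fun k => -Real.sin (ω k * t) * x.fst k + Real.cos (ω k * t) * x.snd k,
      memℓp_rot _ _ (fun k => by rw [neg_sq]; exact Real.sin_sq_add_cos_sq (ω k * t))
        x.fst x.snd⟩)

@[simp] theorem flow_fst (ω : ℕ → ℝ) (t : ℝ) (x : State) (k : ℕ) :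
    (flow ω t x).fst k = Real.cos (ω k * t) * x.fst k + Real.sin (ω k * t) * x.snd k := rfl

@[simp] theorem flow_snd (ω : ℕ → ℝ) (t : ℝ) (x : State) (k : ℕ) :
    (flow ω t x).snd k = -Real.sin (ω k * t) * x.fst k + Real.cos (ω k * t) * x.snd k := rfl

theorem state_ext {x y : State} (h : ∀ k, x.fst k = y.fst k ∧ x.snd k = y.snd k) : x = y := by
  apply WithLp.ofLp_injective
  exact Prod.ext (lp.ext (funext fun k => (h k).1)) (lp.ext (funext fun k => (h k).2))

theorem flow_zero (ω : ℕ → ℝ) (x : State) : flow ω 0 x = x :=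
  state_ext fun k => by simp

theorem flow_add (ω : ℕ → ℝ) (s t : ℝ) (x : State) :
    flow ω (s + t) x = flow ω s (flow ω t x) :=
  state_ext fun k => by
    simp only [flow_fst, flow_snd, mul_add, Real.cos_add, Real.sin_add]
    constructor <;> ring

theorem tendsto_ellTwo {l : Filter ℝ} {F : ℝ → EllTwo} {G : EllTwo} {g : ℕ → ℝ}
    (hg : Summable g) (hb : ∀ h k, (F h k - G k) ^ 2 ≤ g k)
    (hF : ∀ k, Tendsto (fun h => F h k) l (𝓝 (G k))) : Tendsto F l (𝓝 G) := by
  rw [tendsto_iff_norm_sub_tendsto_zero]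
  have h1 : ∀ h, ‖F h - G‖ = Real.sqrt (∑' k, (F h k - G k) ^ 2) := fun h => by
    rw [lp.norm_eq_tsum_rpow (by norm_num), Real.sqrt_eq_rpow]
    simp
  have h2 : Tendsto (fun h => ∑' k, (F h k - G k) ^ 2) l (𝓝 (∑' _ : ℕ, (0 : ℝ))) :=
    tendsto_tsum_of_dominated_convergence hg
      (fun k => by simpa using ((hF k).sub_const (G k)).pow 2)
      (Eventually.of_forall fun h k => by
        rw [Real.norm_of_nonneg (sq_nonneg _)]; exact hb h k)
  simp only [h1]
  simpa using h2.sqrt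

theorem tendsto_state {l : Filter ℝ} {F : ℝ → State} {G : State} {g : ℕ → ℝ}
    (hg : Summable g)
    (hb : ∀ h k, ((F h).fst k - G.fst k) ^ 2 ≤ g k ∧ ((F h).snd k - G.snd k) ^ 2 ≤ g k)
    (hF : ∀ k, Tendsto (fun h => (F h).fst k) l (𝓝 (G.fst k)) ∧
      Tendsto (fun h => (F h).snd k) l (𝓝 (G.snd k))) : Tendsto F l (𝓝 G) :=
  ((WithLp.prod_continuous_toLp 2 EllTwo EllTwo).tendsto (WithLp.ofLp G)).comp
    ((tendsto_ellTwo hg (fun h k => (hb h k).1) fun k => (hF k).1).prodMk_nhds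
      (tendsto_ellTwo hg (fun h k => (hb h k).2) fun k => (hF k).2))

/-- `A` is the infinitesimal generator of the group `flow ω`. -/
theorem genGraph_iff_hasDerivAt (ω : ℕ → ℝ) (x y : State) :
    GenGraph ω x y ↔ HasDerivAt (fun t => flow ω t x) y 0 := by
  have hc : ∀ k, HasDerivAt (fun t => (flow ω t x).fst k) (ω k * x.snd k) 0 ∧
      HasDerivAt (fun t => (flow ω t x).snd k) (-ω k * x.fst k) 0 := fun k => by
    have h0 : HasDerivAt (fun t : ℝ => ω k * t) (ω k) 0 := by
      simpa using (hasDerivAt_id (0 : ℝ)).const_mul (ω k)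
    constructor
    · refine ((h0.cos.mul_const (x.fst k)).add (h0.sin.mul_const (x.snd k))).congr_deriv ?_
      simp
    · refine ((h0.sin.fun_neg.mul_const (x.fst k)).add (h0.cos.mul_const (x.snd k))).congr_deriv ?_
      simp
  constructor
  · intro hA
    rw [hasDerivAt_iff_tendsto_slope]
    refine tendsto_state (g := fun k => 8 * (y.fst k ^ 2 + y.snd k ^ 2))
      (((summable_sq y.fst).add (summable_sq y.snd)).mul_left 8) ?_ ?_
    · intro h k
      have hs : (slope (fun t => flow ω t x) 0 h).fst k =
            h⁻¹ * (Real.cos (ω k * h) - 1) * x.fst k + h⁻¹ * Real.sin (ω k * h) * x.snd k ∧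
          (slope (fun t => flow ω t x) 0 h).snd k =
            -(h⁻¹ * Real.sin (ω k * h)) * x.fst k + h⁻¹ * (Real.cos (ω k * h) - 1) * x.snd k := by
        have e1 : (slope (fun t => flow ω t x) 0 h).fst k =
          (h - 0)⁻¹ * ((flow ω h x).fst k - (flow ω 0 x).fst k) := rfl
        have e2 : (slope (fun t => flow ω t x) 0 h).snd k =
          (h - 0)⁻¹ * ((flow ω h x).snd k - (flow ω 0 x).snd k) := rfl
        rw [e1, e2, flow_zero, flow_fst, flow_snd, sub_zero]
        constructor <;> ring
      have hq : (h⁻¹ * (Real.cos (ω k * h) - 1)) ^ 2 + (h⁻¹ * Real.sin (ω k * h)) ^ 2 ≤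
          ω k ^ 2 := by
        have e : (h⁻¹ * (Real.cos (ω k * h) - 1)) ^ 2 + (h⁻¹ * Real.sin (ω k * h)) ^ 2 =
            h⁻¹ ^ 2 * (2 - 2 * Real.cos (ω k * h)) := by
          linear_combination h⁻¹ ^ 2 * Real.sin_sq_add_cos_sq (ω k * h)
        rw [e]
        rcases eq_or_ne h 0 with rfl | hh
        · simpa using sq_nonneg (ω k)
        · calc h⁻¹ ^ 2 * (2 - 2 * Real.cos (ω k * h)) ≤ h⁻¹ ^ 2 * (ω k * h) ^ 2 := by
                gcongr
                linarith [Real.one_sub_sq_div_two_le_cos (x := ω k * h)]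
            _ = ω k ^ 2 := by field_simp
      rw [hs.1, hs.2, (hA k).1, (hA k).2]
      generalize h⁻¹ * (Real.cos (ω k * h) - 1) = a at hq
      generalize h⁻¹ * Real.sin (ω k * h) = c at hq
      have hm := mul_le_mul_of_nonneg_right hq
        (add_nonneg (sq_nonneg (x.fst k)) (sq_nonneg (x.snd k)))
      constructor
      · nlinarith [sq_nonneg (c * x.fst k - a * x.snd k),
          sq_nonneg (a * x.fst k + c * x.snd k + ω k * x.snd k),
          sq_nonneg (ω k * x.fst k), sq_nonneg (ω k * x.snd k)]
      · nlinarith [sq_nonneg (a * x.fst k + c * x.snd k),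
          sq_nonneg (-c * x.fst k + a * x.snd k - ω k * x.fst k),
          sq_nonneg (ω k * x.fst k), sq_nonneg (ω k * x.snd k)]
    · intro k
      rw [(hA k).1, (hA k).2]
      exact ⟨hasDerivAt_iff_tendsto_slope.1 (hc k).1, hasDerivAt_iff_tendsto_slope.1 (hc k).2⟩
  · intro h k
    have h1 := ((lp.evalCLM ℝ (fun _ : ℕ => ℝ) 2 k).comp
      (WithLp.fstL 2 ℝ EllTwo EllTwo)).hasFDerivAt.comp_hasDerivAt (0 : ℝ) h
    have h2 := ((lp.evalCLM ℝ (fun _ : ℕ => ℝ) 2 k).comp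
      (WithLp.sndL 2 ℝ EllTwo EllTwo)).hasFDerivAt.comp_hasDerivAt (0 : ℝ) h
    exact ⟨h1.unique (hc k).1, h2.unique (hc k).2⟩

/-- The group `flow ω` is strongly continuous. -/
theorem continuous_flow (ω : ℕ → ℝ) (x : State) : Continuous fun t => flow ω t x := by
  refine continuous_iff_continuousAt.2 fun t => ?_
  refine tendsto_state (g := fun k => 16 * (x.fst k ^ 2 + x.snd k ^ 2))
    (((summable_sq x.fst).add (summable_sq x.snd)).mul_left 16) ?_ ?_
  · intro h k
    simp only [flow_fst, flow_snd]
    have key : ∀ c s c' s' p q : ℝ, s ^ 2 + c ^ 2 = 1 → s' ^ 2 + c' ^ 2 = 1 →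
        (c * p + s * q - (c' * p + s' * q)) ^ 2 ≤ 16 * (p ^ 2 + q ^ 2) := by
      intro c s c' s' p q h1 h2
      have h3 : (c - c') ^ 2 + (s - s') ^ 2 ≤ 16 := by
        nlinarith [sq_nonneg (c + c'), sq_nonneg (s + s')]
      nlinarith [mul_le_mul_of_nonneg_right h3 (add_nonneg (sq_nonneg p) (sq_nonneg q)),
        sq_nonneg ((s - s') * p - (c - c') * q)]
    exact ⟨key _ _ _ _ _ _ (Real.sin_sq_add_cos_sq _) (Real.sin_sq_add_cos_sq _),
      key _ _ _ _ _ _ (by rw [neg_sq]; exact Real.cos_sq_add_sin_sq _)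
        (by rw [neg_sq]; exact Real.cos_sq_add_sin_sq _)⟩
  · intro k
    have h1 : Continuous fun h => (flow ω h x).fst k := by simp only [flow_fst]; fun_prop
    have h2 : Continuous fun h => (flow ω h x).snd k := by simp only [flow_snd]; fun_prop
    exact ⟨h1.tendsto t, h2.tendsto t⟩

/-- The control vector `B = (0, b)`. -/
noncomputable def ctrl (b : EllTwo) : State := WithLp.toLp 2 (0, b)

/-- `u ∈ L²(0, T)`. -/
def IsControl (T : ℝ) (u : ℝ → ℝ) : Prop := MemLp u 2 (volume.restrict (Ioc 0 T))

/-- The solution `x(t) = e^{tA} x⁰ + ∫₀ᵗ e^{(t-s)A} B u(s) ds` of `ẋ = A x + B u`,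
`x(0) = x⁰`. -/
noncomputable def solution (ω : ℕ → ℝ) (b : EllTwo) (x₀ : State) (u : ℝ → ℝ) (t : ℝ) : State :=
  flow ω t x₀ + ∫ s in (0 : ℝ)..t, u s • flow ω (t - s) (ctrl b)

/-- The reachable set `R_T(x⁰)`. -/
def reachable (ω : ℕ → ℝ) (b : EllTwo) (T : ℝ) (x₀ : State) : Set State :=
  {x | ∃ u, IsControl T u ∧ solution ω b x₀ u T = x}

/-- The inner product of `V_{0,1}`. -/
noncomputable def vInner (b : EllTwo) (x y : State) : ℝ :=
  ∑' k, (x.fst k * y.fst k + x.snd k * y.snd k) / |b k| ^ 2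

/-- The norm of `V_{0,1}`. -/
noncomputable def vNorm (b : EllTwo) (x : State) : ℝ := Real.sqrt (vInner b x x)

/-- The space `V_{0,1}` of all `(ξ, η)` with `∑ (ξₖ² + ηₖ²) / |bₖ|² < ∞`. -/
def V (b : EllTwo) : Submodule ℝ State where
  carrier := {x | Summable fun k => (x.fst k ^ 2 + x.snd k ^ 2) / |b k| ^ 2}
  zero_mem' := by simp
  add_mem' := by
    intro x y hx hy
    refine Summable.of_nonneg_of_le (fun k => by positivity) (fun k => ?_)
      ((hx.add hy).mul_left 2)
    have h : (x + y).fst k = x.fst k + y.fst k ∧ (x + y).snd k = x.snd k + y.snd k := ⟨rfl, rfl⟩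
    rw [h.1, h.2, ← add_div, ← mul_div_assoc]
    gcongr
    nlinarith [sq_nonneg (x.fst k - y.fst k), sq_nonneg (x.snd k - y.snd k)]
  smul_mem' := by
    intro c x hx
    refine (hx.mul_left (c ^ 2)).congr fun k => ?_
    have h : (c • x).fst k = c * x.fst k ∧ (c • x).snd k = c * x.snd k := ⟨rfl, rfl⟩
    rw [h.1, h.2]
    ring

/-- Every pair of sequences with `∑ (ξₖ² + ηₖ²) / |bₖ|² < ∞` lies in `H`, so nothing is lost by
defining `V_{0,1}` inside `H`. -/
theorem memℓp_of_summable (b : EllTwo) (hb : ∀ k, b k ≠ 0) (ξ η : ℕ → ℝ)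
    (h : Summable fun k => (ξ k ^ 2 + η k ^ 2) / |b k| ^ 2) : Memℓp ξ 2 ∧ Memℓp η 2 := by
  have key : ∀ k, ξ k ^ 2 + η k ^ 2 ≤ ‖b‖ ^ 2 * ((ξ k ^ 2 + η k ^ 2) / |b k| ^ 2) := fun k => by
    have h1 : |b k| ≤ ‖b‖ := lp.norm_apply_le_norm (by norm_num) b k
    have h2 : 0 < |b k| := abs_pos.2 (hb k)
    rw [← mul_div_assoc, le_div_iff₀ (by positivity), mul_comm]
    gcongr
  exact ⟨memℓp_two_of_sq_le (h.mul_left (‖b‖ ^ 2)) fun k => by nlinarith [key k, sq_nonneg (η k)],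
    memℓp_two_of_sq_le (h.mul_left (‖b‖ ^ 2)) fun k => by nlinarith [key k, sq_nonneg (ξ k)]⟩

/-- The linear subspace `W` of `H`, equipped with `ip`, is a Hilbert space that is continuously
embedded in `H`: it is the image of a Hilbert space `E` under an injective bounded operator that
carries the inner product of `E` to `ip`. -/
def IsHilbertSubspaceWith (W : Submodule ℝ State) (ip : State → State → ℝ) : Prop :=
  ∃ (E : Type) (_ : NormedAddCommGroup E) (_ : InnerProductSpace ℝ E) (_ : CompleteSpace E)
    (ι : E →L[ℝ] State), Function.Injective ι ∧ Set.range ι = (W : Set State) ∧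
      ∀ x y : E, inner ℝ x y = ip (ι x) (ι y)

/-- `W` is a Hilbert subspace of `H`, for some inner product of its own. -/
def IsHilbertSubspace (W : Submodule ℝ State) : Prop := ∃ ip, IsHilbertSubspaceWith W ip

/-- Exact controllability in `W` in time `T`: every point of `W` can be steered to every point of
`W` in time `T` by an `L²` control. -/
def ExactlyControllableIn (ω : ℕ → ℝ) (b : EllTwo) (T : ℝ) (W : Submodule ℝ State) : Prop :=
  ∀ x₀ ∈ W, ∀ x₁ ∈ W, ∃ u, IsControl T u ∧ solution ω b x₀ u T = x₁

/-- Well-posedness (admissibility) in `V_{0,1}`: on every interval `[0, τ]`, a solution that starts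
in `V_{0,1}` stays in `V_{0,1}`, is continuous with values in `V_{0,1}`, and depends continuously on
the initial state and on the control. -/
def WellPosedInV (ω : ℕ → ℝ) (b : EllTwo) : Prop :=
  ∀ τ > 0, ∃ C : ℝ, ∀ x₀ ∈ V b, ∀ u, IsControl τ u →
    (∀ t ∈ Icc 0 τ, solution ω b x₀ u t ∈ V b) ∧
    (∀ t ∈ Icc 0 τ, Tendsto
      (fun s => vNorm b (solution ω b x₀ u s - solution ω b x₀ u t)) (𝓝[Icc 0 τ] t) (𝓝 0)) ∧
    (∀ t ∈ Icc 0 τ, vNorm b (solution ω b x₀ u t) ≤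
      C * (vNorm b x₀ + Real.sqrt (∫ s in (0 : ℝ)..τ, u s ^ 2)))

end Oscillator

namespace Oscillator

/-! In the coordinates `ηₖ + i ξₖ = bₖ yₖ` the space `V b` becomes `ℓ²(ℂ)` isometrically (`embed`),
the group becomes multiplication by `e^{i ωₖ t}` (`rotate`), and the solution from `y` is `e^{i ωₖ
t} (yₖ + mₖ(t))` with `mₖ(t) = ∫₀ᵗ u(s) e^{-i ωₖ s} ds` (`solution_embed`). Every claim thus
concerns the moment map `u ↦ (mₖ)`.

Its boundedness into `ℓ²(ℂ)` keeps solutions in `V b` and gives well-posedness; its surjectivity at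
time `T` gives exact controllability. By duality the two are the upper and lower bounds of `∫ |∑ Re
(zₖ e^{i ωₖ t})|²` by `∑ |zₖ|²`: the upper one yields `bessel`, both together `exists_moment_eq`.
Maximality follows because any admissible `W` contains `0`, so `W` lies in the set reachable from
`0`, hence in `V b`.

Both bounds are Ingham inequalities, the lower one needing `T > 2π/ω_*`. Real sums carry the
frequencies `±ωₖ`, and the gap `2ω₀` across the origin may be small. For `k ≥ 1`, however, `ωₖ + ωⱼ
≥ (k + j) γ`, so the modes without index `0` obey Ingham's estimate
(`abs_integral_cos_mul_trigSum_sq_sub_le`). The mode `0` is then restored by an averaging argument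
that costs an arbitrarily short piece of the interval (`le_integral_trigSum_sq`). -/

/-! ### Ingham's weighted estimate for the modes `k ≥ 1`. -/

/-- The real trigonometric sum `∑ k ∈ F, Re (zₖ e^{i ωₖ t})`. -/
noncomputable def trigSum (ω : ℕ → ℝ) (F : Finset ℕ) (z : ℕ → ℂ) (t : ℝ) : ℝ :=
  ∑ k ∈ F, ((z k).re * Real.cos (ω k * t) - (z k).im * Real.sin (ω k * t))

@[fun_prop]
theorem continuous_trigSum (ω : ℕ → ℝ) (F : Finset ℕ) (z : ℕ → ℂ) :
    Continuous (trigSum ω F z) := by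
  unfold trigSum; fun_prop

/-- The choice `α R = π / 2` makes the weight vanish at `±R`, so its transform decays like `l⁻²` and
the off-diagonal terms of the quadratic form are summable. -/
theorem integral_cos_mul_cos {α R l : ℝ} (h : α * R = Real.pi / 2) (hl : α ^ 2 - l ^ 2 ≠ 0) :
    ∫ t in (-R)..R, Real.cos (α * t) * Real.cos (l * t) =
      2 * α * Real.cos (l * R) / (α ^ 2 - l ^ 2) := by
  have hd : ∀ t : ℝ, HasDerivAt (fun t => (α * Real.sin (α * t) * Real.cos (l * t) -
      l * Real.cos (α * t) * Real.sin (l * t)) / (α ^ 2 - l ^ 2))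
      (Real.cos (α * t) * Real.cos (l * t)) t := by
    intro t
    have ha : HasDerivAt (fun t : ℝ => α * t) α t := by
      simpa using (hasDerivAt_id t).const_mul α
    have hb : HasDerivAt (fun t : ℝ => l * t) l t := by
      simpa using (hasDerivAt_id t).const_mul l
    refine ((((ha.sin.const_mul α).mul hb.cos).sub
      ((ha.cos.const_mul l).mul hb.sin)).div_const _).congr_deriv ?_
    field_simp
    ring
  rw [intervalIntegral.integral_eq_sub_of_hasDerivAt (fun t _ => hd t)
    (Continuous.intervalIntegrable (by fun_prop) _ _)]
  simp only [mul_neg, Real.sin_neg, Real.cos_neg, h, Real.sin_pi_div_two, Real.cos_pi_div_two]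
  ring

theorem integral_odd {f : ℝ → ℝ} (hf : ∀ t, f (-t) = -f t) (R : ℝ) :
    ∫ t in (-R)..R, f t = 0 := by
  have h := intervalIntegral.integral_comp_neg (a := -R) (b := R) f
  simp only [hf, intervalIntegral.integral_neg, neg_neg] at h
  linarith

/-- The Fourier transform of the weight `cos (α t)` on `[-R, R]`. -/
noncomputable def cosWeight (α R l : ℝ) : ℝ :=
  ∫ t in (-R)..R, Real.cos (α * t) * Real.cos (l * t)

theorem cosWeight_zero {α R : ℝ} (hα : 0 < α) (h : α * R = Real.pi / 2) :
    cosWeight α R 0 = 2 / α := by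
  rw [cosWeight, integral_cos_mul_cos h (by simp [hα.ne'])]
  simp; field_simp

/-- Since `α² < γ² / 4`, the denominator satisfies `l² - α² ≥ m²γ² - γ²/4 = (γ²/4)(4m² - 1)`. The
bound is arranged as the value at `0` times `(2α/γ)² < 1` times a term of a telescoping series. -/
theorem abs_cosWeight_le {α R γ : ℝ} (hα : 0 < α) (h : α * R = Real.pi / 2) (hγ : 2 * α < γ)
    {l : ℝ} {m : ℕ} (hm : 1 ≤ m) (hl : m * γ ≤ |l|) :
    |cosWeight α R l| ≤ 2 / α * (2 * α / γ) ^ 2 * (1 / (4 * (m : ℝ) ^ 2 - 1)) := by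
  have hm' : (1 : ℝ) ≤ m := by exact_mod_cast hm
  have hγ0 : 0 < γ := by linarith
  have hl2 : (m : ℝ) ^ 2 * γ ^ 2 ≤ l ^ 2 := by
    rw [← mul_pow, ← sq_abs l]; gcongr
  have hγ2 : 4 * α ^ 2 ≤ γ ^ 2 := by nlinarith
  have h4 : (0 : ℝ) < 4 * (m : ℝ) ^ 2 - 1 := by nlinarith
  have hlow : γ ^ 2 / 4 * (4 * (m : ℝ) ^ 2 - 1) ≤ l ^ 2 - α ^ 2 := by nlinarith
  have hpos : 0 < γ ^ 2 / 4 * (4 * (m : ℝ) ^ 2 - 1) := by positivity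
  rw [cosWeight, integral_cos_mul_cos h (by linarith), abs_div, abs_mul, abs_mul,
    abs_of_pos hα, abs_two, abs_sub_comm, abs_of_pos (hpos.trans_le hlow)]
  calc 2 * α * |Real.cos (l * R)| / (l ^ 2 - α ^ 2)
      ≤ 2 * α * 1 / (γ ^ 2 / 4 * (4 * (m : ℝ) ^ 2 - 1)) := by
        gcongr; exact Real.abs_cos_le_one _
    _ = _ := by field_simp; norm_num

theorem sum_Icc_inv_four_sq_sub_one (N : ℕ) :
    ∑ m ∈ Finset.Icc 1 N, 1 / (4 * (m : ℝ) ^ 2 - 1) ≤ 1 / 2 := by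
  -- The series telescopes: `1/(4m² - 1) = (1/(2m - 1) - 1/(2m + 1)) / 2`.
  have h : ∑ m ∈ Finset.Icc 1 N, 1 / (4 * (m : ℝ) ^ 2 - 1) = 1 / 2 - 1 / (2 * (2 * (N : ℝ) + 1)) := by
    induction N with
    | zero => norm_num
    | succ n ih =>
      rw [Finset.sum_Icc_succ_top (by omega), ih]
      have h1 : (2 * (n : ℝ) + 1) ≠ 0 := by positivity
      have h2 : (2 * (n : ℝ) + 3) ≠ 0 := by positivity
      have h3 : 4 * ((n + 1 : ℕ) : ℝ) ^ 2 - 1 = (2 * n + 1) * (2 * n + 3) := by push_cast; ring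
      have h4 : 2 * (2 * ((n + 1 : ℕ) : ℝ) + 1) = 2 * (2 * n + 3) := by push_cast; ring
      rw [h3, h4]
      field_simp
      ring
  rw [h]
  have : (0 : ℝ) ≤ 1 / (2 * (2 * (N : ℝ) + 1)) := by positivity
  linarith

theorem sum_inv_four_sq_sub_one_le (S : Finset ℕ) (hS : ∀ m ∈ S, 1 ≤ m) :
    ∑ m ∈ S, 1 / (4 * (m : ℝ) ^ 2 - 1) ≤ 1 / 2 := by
  refine le_trans (Finset.sum_le_sum_of_subset_of_nonneg (t := Finset.Icc 1 (S.sup id)) ?_ ?_)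
    (sum_Icc_inv_four_sq_sub_one _)
  · intro m hm
    exact Finset.mem_Icc.2 ⟨hS m hm, Finset.le_sup (f := id) hm⟩
  · intro m hm _
    have : (1 : ℝ) ≤ m := by exact_mod_cast (Finset.mem_Icc.1 hm).1
    have : (0 : ℝ) < 4 * (m : ℝ) ^ 2 - 1 := by nlinarith
    positivity

/-- With truncated subtraction, `(k - j) + (j - k)` is `|k - j|`. The values `j - k` for `j > k` are
distinct positive integers and contribute at most `1/2`. The values `k - j` for `1 ≤ j < k` stay
below `k` and the values `k + j` above it, so together they also contribute at most `1/2`. -/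
theorem row_sum_le (F : Finset ℕ) (hF : ∀ k ∈ F, 1 ≤ k) (k : ℕ) :
    ∑ j ∈ F, ((if j = k then 0 else 1 / (4 * (((k - j) + (j - k) : ℕ) : ℝ) ^ 2 - 1)) +
      1 / (4 * ((k + j : ℕ) : ℝ) ^ 2 - 1)) ≤ 1 := by
  let q : ℕ → ℝ := fun m => 1 / (4 * (m : ℝ) ^ 2 - 1)
  have h1 : ∑ j ∈ F, (if j = k then 0 else q ((k - j) + (j - k))) =
      ∑ j ∈ F with j < k, q (k - j) + ∑ j ∈ F with k < j, q (j - k) := by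
    rw [Finset.sum_filter, Finset.sum_filter, ← Finset.sum_add_distrib]
    refine Finset.sum_congr rfl fun j _ => ?_
    rcases lt_trichotomy j k with h | h | h
    · simp [h, h.ne, h.not_gt, Nat.sub_eq_zero_of_le h.le]
    · simp [h]
    · simp [h, h.ne', h.not_gt, Nat.sub_eq_zero_of_le h.le]
  have h2 : ∑ j ∈ F with k < j, q (j - k) ≤ 1 / 2 := by
    rw [← Finset.sum_image (s := F.filter (k < ·)) (g := fun j => j - k) (f := q)]
    · refine sum_inv_four_sq_sub_one_le _ fun m hm => ?_
      obtain ⟨j, hj, rfl⟩ := Finset.mem_image.1 hm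
      have := (Finset.mem_filter.1 hj).2
      omega
    · intro i hi j hj hij
      simp at hi hj hij
      omega
  have h3 : ∑ j ∈ F with j < k, q (k - j) + ∑ j ∈ F, q (k + j) ≤ 1 / 2 := by
    rw [← Finset.sum_image (s := F.filter (· < k)) (g := fun j => k - j) (f := q),
      ← Finset.sum_image (s := F) (g := fun j => k + j) (f := q), ← Finset.sum_union]
    · refine sum_inv_four_sq_sub_one_le _ fun m hm => ?_
      rcases Finset.mem_union.1 hm with hm | hm
      · obtain ⟨j, hj, rfl⟩ := Finset.mem_image.1 hm
        have := (Finset.mem_filter.1 hj).2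
        omega
      · obtain ⟨j, hj, rfl⟩ := Finset.mem_image.1 hm
        have := hF j hj
        omega
    · rw [Finset.disjoint_left]
      intro m hm hm'
      obtain ⟨j, hj, rfl⟩ := Finset.mem_image.1 hm
      obtain ⟨i, hi, h⟩ := Finset.mem_image.1 hm'
      have := hF i hi
      omega
    · intro i _ j _ hij
      simp at hij
      omega
    · intro i hi j hj hij
      simp at hi hj hij
      omega
  rw [Finset.sum_add_distrib]
  change ∑ j ∈ F, (if j = k then 0 else q ((k - j) + (j - k))) + ∑ j ∈ F, q (k + j) ≤ 1
  linarith

/-- Schur's test for a symmetric kernel. -/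
theorem sum_sum_mul_le_of_row_sum_le {ι : Type*} (F : Finset ι) (r : ι → ℝ) (B : ι → ι → ℝ)
    (hB : ∀ i ∈ F, ∀ j ∈ F, 0 ≤ B i j) (hsymm : ∀ i j, B i j = B j i) {D : ℝ}
    (hrow : ∀ i ∈ F, ∑ j ∈ F, B i j ≤ D) :
    ∑ i ∈ F, ∑ j ∈ F, r i * r j * B i j ≤ D * ∑ i ∈ F, r i ^ 2 := by
  have h1 : ∑ i ∈ F, ∑ j ∈ F, r i * r j * B i j ≤
      ∑ i ∈ F, ∑ j ∈ F, (r i ^ 2 * B i j / 2 + r j ^ 2 * B i j / 2) := by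
    refine Finset.sum_le_sum fun i hi => Finset.sum_le_sum fun j hj => ?_
    nlinarith [mul_nonneg (sq_nonneg (r i - r j)) (hB i hi j hj)]
  have h2 : ∑ i ∈ F, ∑ j ∈ F, r j ^ 2 * B i j / 2 = ∑ i ∈ F, ∑ j ∈ F, r i ^ 2 * B i j / 2 := by
    rw [Finset.sum_comm]
    exact Finset.sum_congr rfl fun i _ => Finset.sum_congr rfl fun j _ => by rw [hsymm]
  have h3 : ∑ i ∈ F, ∑ j ∈ F, r i ^ 2 * B i j / 2 ≤ D * (∑ i ∈ F, r i ^ 2) / 2 := by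
    rw [Finset.mul_sum, Finset.sum_div]
    refine Finset.sum_le_sum fun i hi => ?_
    rw [← Finset.sum_div, ← Finset.mul_sum]
    nlinarith [mul_le_mul_of_nonneg_left (hrow i hi) (sq_nonneg (r i))]
  simp only [Finset.sum_add_distrib] at h1
  linarith

/-- The mixed sine-cosine products are odd and integrate to zero; the rest is a product-to-sum
formula. -/
theorem integral_cos_mul_mode_mul_mode (α R : ℝ) (z w : ℂ) (l m : ℝ) :
    ∫ t in (-R)..R, Real.cos (α * t) * ((z.re * Real.cos (l * t) - z.im * Real.sin (l * t)) *
      (w.re * Real.cos (m * t) - w.im * Real.sin (m * t))) =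
    (z.re * w.re + z.im * w.im) / 2 * cosWeight α R (l - m) +
      (z.re * w.re - z.im * w.im) / 2 * cosWeight α R (l + m) := by
  have h0 := integral_odd (R := R) (f := fun t => Real.cos (α * t) *
    (z.re * w.im * (Real.cos (l * t) * Real.sin (m * t)) +
      z.im * w.re * (Real.sin (l * t) * Real.cos (m * t)))) (by intro t; simp; ring)
  unfold cosWeight
  rw [← intervalIntegral.integral_const_mul, ← intervalIntegral.integral_const_mul,
    ← intervalIntegral.integral_add (Continuous.intervalIntegrable (by fun_prop) _ _)
      (Continuous.intervalIntegrable (by fun_prop) _ _),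
    ← sub_eq_zero, ← intervalIntegral.integral_sub
      (Continuous.intervalIntegrable (by fun_prop) _ _)
      (Continuous.intervalIntegrable (by fun_prop) _ _), ← neg_eq_zero,
    ← intervalIntegral.integral_neg, ← h0]
  refine intervalIntegral.integral_congr fun t _ => ?_
  simp only [sub_mul, add_mul, Real.cos_sub, Real.cos_add]
  ring

/-- Ingham's estimate with the weight `cos (α t)`. -/
theorem abs_integral_cos_mul_trigSum_sq_sub_le {ω : ℕ → ℝ} {γ α R : ℝ}
    (hω : ∀ j k, j ≤ k → (k - j : ℕ) * γ ≤ ω k - ω j) (hω' : ∀ k, k * γ ≤ ω k)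
    (hα : 0 < α) (h : α * R = Real.pi / 2) (hγ : 2 * α < γ)
    (F : Finset ℕ) (hF : ∀ k ∈ F, 1 ≤ k) (z : ℕ → ℂ) :
    |(∫ t in (-R)..R, Real.cos (α * t) * trigSum ω F z t ^ 2) - 1 / α * ∑ k ∈ F, ‖z k‖ ^ 2| ≤
      1 / α * (2 * α / γ) ^ 2 * ∑ k ∈ F, ‖z k‖ ^ 2 := by
  set W := cosWeight α R with hW
  have hγ0 : 0 < γ := by linarith
  have hexp : ∫ t in (-R)..R, Real.cos (α * t) * trigSum ω F z t ^ 2 =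
      ∑ k ∈ F, ∑ j ∈ F, (((z k).re * (z j).re + (z k).im * (z j).im) / 2 * W (ω k - ω j) +
        ((z k).re * (z j).re - (z k).im * (z j).im) / 2 * W (ω k + ω j)) := by
    simp only [← integral_cos_mul_mode_mul_mode, hW]
    simp only [sq, trigSum, Finset.sum_mul_sum]
    simp only [Finset.mul_sum]
    rw [intervalIntegral.integral_finsetSum fun k _ =>
      Continuous.intervalIntegrable (by fun_prop) _ _]
    refine Finset.sum_congr rfl fun k _ => ?_
    rw [intervalIntegral.integral_finsetSum fun j _ =>
      Continuous.intervalIntegrable (by fun_prop) _ _]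
  -- Only the zero-frequency part of the diagonal is the main term. The part with frequency `2 ωₖ`
  -- stays in the error, where it accounts for the term `j = k` of the `k + j` sum.
  have hdiag : 1 / α * ∑ k ∈ F, ‖z k‖ ^ 2 = ∑ k ∈ F, ∑ j ∈ F,
      if j = k then ((z k).re * (z j).re + (z k).im * (z j).im) / 2 * W (ω k - ω j) else 0 := by
    rw [Finset.mul_sum]
    refine Finset.sum_congr rfl fun k hk => ?_
    rw [Finset.sum_ite_eq' F k, if_pos hk, sub_self, hW, cosWeight_zero hα h,
      ← Complex.normSq_eq_norm_sq, Complex.normSq_apply]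
    ring
  rw [hexp, hdiag, ← Finset.sum_sub_distrib]
  simp only [← Finset.sum_sub_distrib]
  have hre : ∀ z w : ℂ, |z.re * w.re + z.im * w.im| ≤ ‖z‖ * ‖w‖ := fun z w => by
    simpa using Complex.abs_re_le_norm (z * (starRingEnd ℂ) w)
  have hre' : ∀ z w : ℂ, |z.re * w.re - z.im * w.im| ≤ ‖z‖ * ‖w‖ := fun z w => by
    simpa using Complex.abs_re_le_norm (z * w)
  let D := 1 / α * (2 * α / γ) ^ 2
  let B : ℕ → ℕ → ℝ := fun k j => D *
    ((if j = k then 0 else 1 / (4 * (((k - j) + (j - k) : ℕ) : ℝ) ^ 2 - 1)) +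
      1 / (4 * ((k + j : ℕ) : ℝ) ^ 2 - 1))
  have hD : 0 ≤ D := by positivity
  have hq : ∀ m : ℕ, 1 ≤ m → 0 ≤ 1 / (4 * (m : ℝ) ^ 2 - 1) := fun m hm => by
    have : (1 : ℝ) ≤ m := by exact_mod_cast hm
    have : (0 : ℝ) < 4 * (m : ℝ) ^ 2 - 1 := by nlinarith
    positivity
  have hterm : ∀ k ∈ F, ∀ j ∈ F,
      |((z k).re * (z j).re + (z k).im * (z j).im) / 2 * W (ω k - ω j) +
        ((z k).re * (z j).re - (z k).im * (z j).im) / 2 * W (ω k + ω j) -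
        (if j = k then ((z k).re * (z j).re + (z k).im * (z j).im) / 2 * W (ω k - ω j) else 0)| ≤
      ‖z k‖ * ‖z j‖ * B k j := by
    intro k hk j hj
    have hplus : |((z k).re * (z j).re - (z k).im * (z j).im) / 2 * W (ω k + ω j)| ≤
        ‖z k‖ * ‖z j‖ * (D * (1 / (4 * ((k + j : ℕ) : ℝ) ^ 2 - 1))) := by
      have hw := abs_cosWeight_le (l := ω k + ω j) (m := k + j) hα h hγ
        (by have := hF k hk; omega)
        (by push_cast; exact le_trans (by linarith [hω' k, hω' j]) (le_abs_self _))
      rw [abs_mul, abs_div, abs_two]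
      calc _ ≤ ‖z k‖ * ‖z j‖ / 2 *
              (2 / α * (2 * α / γ) ^ 2 * (1 / (4 * ((k + j : ℕ) : ℝ) ^ 2 - 1))) := by
            gcongr
            exact hre' _ _
        _ = _ := by simp only [D]; ring
    by_cases hjk : j = k
    · simp only [hjk, if_true, B, zero_add] at hplus ⊢
      simpa using hplus
    · have hminus : |((z k).re * (z j).re + (z k).im * (z j).im) / 2 * W (ω k - ω j)| ≤
          ‖z k‖ * ‖z j‖ * (D * (1 / (4 * (((k - j) + (j - k) : ℕ) : ℝ) ^ 2 - 1))) := by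
        have hw := abs_cosWeight_le (l := ω k - ω j) (m := (k - j) + (j - k)) hα h hγ
          (by omega) (by
            rcases le_total j k with hle | hle
            · rw [Nat.sub_eq_zero_of_le hle, add_zero]
              exact (hω j k hle).trans (le_abs_self _)
            · rw [Nat.sub_eq_zero_of_le hle, zero_add, abs_sub_comm]
              exact (hω k j hle).trans (le_abs_self _))
        rw [abs_mul, abs_div, abs_two]
        calc _ ≤ ‖z k‖ * ‖z j‖ / 2 * (2 / α * (2 * α / γ) ^ 2 *
                (1 / (4 * (((k - j) + (j - k) : ℕ) : ℝ) ^ 2 - 1))) := by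
              gcongr
              exact hre _ _
          _ = _ := by simp only [D]; ring
      simp only [hjk, if_false, sub_zero, B]
      refine (abs_add_le _ _).trans ((add_le_add hminus hplus).trans_eq ?_)
      ring
  calc _ ≤ ∑ k ∈ F, ∑ j ∈ F, ‖z k‖ * ‖z j‖ * B k j :=
        (Finset.abs_sum_le_sum_abs _ _).trans (Finset.sum_le_sum fun k hk =>
          (Finset.abs_sum_le_sum_abs _ _).trans (Finset.sum_le_sum fun j hj => hterm k hk j hj))
    _ ≤ D * ∑ k ∈ F, ‖z k‖ ^ 2 := by
        refine sum_sum_mul_le_of_row_sum_le F _ B (fun k hk j hj => ?_) (fun k j => ?_)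
          (fun k hk => ?_)
        · refine mul_nonneg hD (add_nonneg ?_ (hq _ (by have := hF k hk; omega)))
          split_ifs with hjk
          · exact le_rfl
          · exact hq _ (by omega)
        · simp only [B, eq_comm (a := j), add_comm k j, add_comm (k - j)]
        · simp only [B]
          rw [← Finset.mul_sum]
          exact mul_le_of_le_one_right hD (row_sum_le F hF k)

/-! ### Unweighted two-sided bounds for the modes `k ≥ 1`. -/

theorem integral_trigSum_sq_le_of_one_le {ω : ℕ → ℝ} {γ : ℝ} (hγ : 0 < γ)
    (hω : ∀ j k, j ≤ k → (k - j : ℕ) * γ ≤ ω k - ω j) (hω' : ∀ k, k * γ ≤ ω k)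
    {R : ℝ} (hR : 0 ≤ R) :
    ∃ C : ℝ, 0 ≤ C ∧ ∀ F : Finset ℕ, (∀ k ∈ F, 1 ≤ k) → ∀ z : ℕ → ℂ,
      ∫ t in (-R)..R, trigSum ω F z t ^ 2 ≤ C * ∑ k ∈ F, ‖z k‖ ^ 2 := by
  have hπ := Real.pi_pos
  -- The summand `2π/γ` forces `2α < γ`; the factor `3/2` forces `α R ≤ π/3`, so the weight is at
  -- least `1/2` on `[-R, R]`.
  set R' := 3 * R / 2 + 2 * Real.pi / γ with hR'
  have hRγ : 0 < 2 * Real.pi / γ := by positivity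
  have hR'0 : 0 < R' := by positivity
  set α := Real.pi / (2 * R') with hα
  have hα0 : 0 < α := by positivity
  have hαR' : α * R' = Real.pi / 2 := by rw [hα]; field_simp
  have hαγ : 2 * α < γ := by
    have : α * (2 * Real.pi / γ) ≤ Real.pi / 2 := by
      rw [← hαR']; gcongr; rw [hR']; linarith
    rw [← mul_div_assoc, div_le_iff₀ hγ] at this
    nlinarith
  have hαR : α * R ≤ Real.pi / 3 := by
    have : α * (3 * R / 2) ≤ Real.pi / 2 := by
      rw [← hαR']; gcongr; rw [hR']; linarith
    linarith
  refine ⟨2 * (1 / α + 1 / α * (2 * α / γ) ^ 2), by positivity, fun F hF z => ?_⟩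
  have key := (abs_le.1 (abs_integral_cos_mul_trigSum_sq_sub_le hω hω' hα0 hαR' hαγ F hF z)).2
  have h1 : ∫ t in (-R)..R, trigSum ω F z t ^ 2 ≤
      ∫ t in (-R)..R, 2 * (Real.cos (α * t) * trigSum ω F z t ^ 2) := by
    refine intervalIntegral.integral_mono_on (by linarith)
      (Continuous.intervalIntegrable (by fun_prop) _ _)
      (Continuous.intervalIntegrable (by fun_prop) _ _) fun t ht => ?_
    have hc : 1 / 2 ≤ Real.cos (α * t) := by
      rw [← Real.cos_pi_div_three, ← Real.cos_abs (α * t)]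
      refine Real.cos_le_cos_of_nonneg_of_le_pi (abs_nonneg _) (by linarith) ?_
      rw [abs_mul, abs_of_pos hα0]
      exact (mul_le_mul_of_nonneg_left (abs_le.2 ht) hα0.le).trans hαR
    nlinarith [sq_nonneg (trigSum ω F z t)]
  have h2 : ∫ t in (-R)..R, 2 * (Real.cos (α * t) * trigSum ω F z t ^ 2) ≤
      ∫ t in (-R')..R', 2 * (Real.cos (α * t) * trigSum ω F z t ^ 2) := by
    have hRR : R ≤ R' := by rw [hR']; linarith
    refine intervalIntegral.integral_mono_interval (by linarith) (by linarith) hRR ?_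
      (Continuous.intervalIntegrable (by fun_prop) _ _)
    refine (ae_restrict_iff' measurableSet_Ioc).2 (Eventually.of_forall fun t ht => ?_)
    have hc : 0 ≤ Real.cos (α * t) := by
      refine Real.cos_nonneg_of_neg_pi_div_two_le_of_le ?_ ?_ <;> rw [← hαR'] <;>
        nlinarith [ht.1, ht.2]
    simp only [Pi.zero_apply]
    positivity
  rw [intervalIntegral.integral_const_mul] at h2
  rw [intervalIntegral.integral_const_mul] at h1
  rw [intervalIntegral.integral_const_mul] at h2
  linarith

/-- The weight is at most `1`, so the weighted estimate already bounds from below. With `α =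
π/(2R)`, the condition `2α < γ` is exactly `R > π/γ`. -/
theorem le_integral_trigSum_sq_of_one_le {ω : ℕ → ℝ} {γ : ℝ} (hγ : 0 < γ)
    (hω : ∀ j k, j ≤ k → (k - j : ℕ) * γ ≤ ω k - ω j) (hω' : ∀ k, k * γ ≤ ω k)
    {R : ℝ} (hR : Real.pi / γ < R) :
    ∃ c : ℝ, 0 < c ∧ ∀ F : Finset ℕ, (∀ k ∈ F, 1 ≤ k) → ∀ z : ℕ → ℂ,
      c * ∑ k ∈ F, ‖z k‖ ^ 2 ≤ ∫ t in (-R)..R, trigSum ω F z t ^ 2 := by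
  have hπ := Real.pi_pos
  have hR0 : 0 < R := lt_trans (by positivity) hR
  set α := Real.pi / (2 * R) with hα
  have hα0 : 0 < α := by positivity
  have hαR : α * R = Real.pi / 2 := by rw [hα]; field_simp
  have hαγ : 2 * α < γ := by
    rw [div_lt_iff₀ hγ] at hR
    nlinarith
  have hlt : (2 * α / γ) ^ 2 < 1 := by
    rw [sq_lt_one_iff₀ (by positivity)]
    exact (div_lt_one hγ).2 hαγ
  refine ⟨1 / α - 1 / α * (2 * α / γ) ^ 2, ?_, fun F hF z => ?_⟩
  · have : 0 < 1 / α := by positivity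
    nlinarith
  have key := (abs_le.1 (abs_integral_cos_mul_trigSum_sq_sub_le hω hω' hα0 hαR hαγ F hF z)).1
  have h1 : ∫ t in (-R)..R, Real.cos (α * t) * trigSum ω F z t ^ 2 ≤
      ∫ t in (-R)..R, trigSum ω F z t ^ 2 := by
    refine intervalIntegral.integral_mono_on (by linarith)
      (Continuous.intervalIntegrable (by fun_prop) _ _)
      (Continuous.intervalIntegrable (by fun_prop) _ _) fun t _ => ?_
    exact mul_le_of_le_one_left (sq_nonneg _) (Real.cos_le_one _)
  linarith

/-! ### Restoring the lowest mode by averaging. -/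

theorem trigSum_eq_add_erase (ω : ℕ → ℝ) {F : Finset ℕ} (hF : 0 ∈ F) (z : ℕ → ℂ) (t : ℝ) :
    trigSum ω F z t = ((z 0).re * Real.cos (ω 0 * t) - (z 0).im * Real.sin (ω 0 * t)) +
      trigSum ω (F.erase 0) z t :=
  (Finset.add_sum_erase F _ hF).symm

theorem mode_sq_le (z : ℂ) (x : ℝ) : (z.re * Real.cos x - z.im * Real.sin x) ^ 2 ≤ ‖z‖ ^ 2 := by
  rw [← Complex.normSq_eq_norm_sq, Complex.normSq_apply]
  nlinarith [sq_nonneg (z.re * Real.sin x + z.im * Real.cos x), Real.sin_sq_add_cos_sq x,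
    congrArg (· * (z.re ^ 2 + z.im ^ 2)) (Real.sin_sq_add_cos_sq x)]

/-- Cauchy–Schwarz, obtained by expanding the nonnegative integral of `(2δ f - I)²`. -/
theorem sq_integral_le {f : ℝ → ℝ} (hf : Continuous f) {δ : ℝ} (hδ : 0 < δ) :
    (∫ s in (-δ)..δ, f s) ^ 2 ≤ 2 * δ * ∫ s in (-δ)..δ, f s ^ 2 := by
  set I := ∫ s in (-δ)..δ, f s with hI
  have h : 0 ≤ ∫ s in (-δ)..δ, (2 * δ * f s - I) ^ 2 :=
    intervalIntegral.integral_nonneg (by linarith) fun _ _ => sq_nonneg _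
  have h2 : ∫ s in (-δ)..δ, (2 * δ * f s - I) ^ 2 =
      4 * δ ^ 2 * (∫ s in (-δ)..δ, f s ^ 2) - 4 * δ * I * I + 2 * δ * I ^ 2 := by
    have : ∀ s, (2 * δ * f s - I) ^ 2 = 4 * δ ^ 2 * f s ^ 2 - 4 * δ * I * f s + I ^ 2 :=
      fun s => by ring
    simp only [this]
    rw [intervalIntegral.integral_add (Continuous.intervalIntegrable (by fun_prop) _ _)
        (Continuous.intervalIntegrable (by fun_prop) _ _),
      intervalIntegral.integral_sub (Continuous.intervalIntegrable (by fun_prop) _ _)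
        (Continuous.intervalIntegrable (by fun_prop) _ _),
      intervalIntegral.integral_const_mul, intervalIntegral.integral_const_mul, ← hI, intervalIntegral.integral_const, smul_eq_mul]
    ring
  rw [h2] at h
  have : 0 ≤ 2 * δ * (2 * δ * (∫ s in (-δ)..δ, f s ^ 2) - I ^ 2) := by linarith
  have := nonneg_of_mul_nonneg_right this (by positivity)
  linarith

/-- Up to `π`, strict concavity of the sine makes its chord slopes from `0` decrease. Beyond `π`,
`sinc y ≤ 1/y < 1/π`, while Jordan's inequality gives `sinc x ≥ 2/π`. -/
theorem sinc_lt_sinc {x y : ℝ} (hx : 0 < x) (hx2 : x ≤ Real.pi / 2) (hxy : x < y) :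
    Real.sinc y < Real.sinc x := by
  have hπ := Real.pi_pos
  have hy : 0 < y := hx.trans hxy
  rw [Real.sinc_of_ne_zero hx.ne', Real.sinc_of_ne_zero hy.ne']
  rcases le_or_gt y Real.pi with h | h
  · have := strictConcaveOn_sin_Icc.slope_anti_adjacent (x := 0) (y := x) (z := y)
      ⟨le_rfl, hπ.le⟩ ⟨hy.le, h⟩ hx hxy
    rw [Real.sin_zero, sub_zero, sub_zero, div_lt_div_iff₀ (by linarith) hx] at this
    rw [div_lt_div_iff₀ hy hx]
    nlinarith
  · have h1 : Real.sin y / y ≤ 1 / y := by gcongr; exact Real.sin_le_one y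
    have h2 : 1 / y < 1 / Real.pi := one_div_lt_one_div_of_lt hπ h
    have h3 : 2 / Real.pi ≤ Real.sin x / x := by
      rw [le_div_iff₀ hx]; exact Real.mul_le_sin hx.le hx2
    have h4 : 1 / Real.pi ≤ 2 / Real.pi := by gcongr; norm_num
    linarith

/-- Averaging over `[t - δ, t + δ]` acts diagonally on modes, with multiplier `sinc (l δ)`. -/
theorem integral_mode_add (z : ℂ) {l δ : ℝ} (hl : l ≠ 0) (hδ : δ ≠ 0) (t : ℝ) :
    ∫ s in (-δ)..δ, (z.re * Real.cos (l * (t + s)) - z.im * Real.sin (l * (t + s))) =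
      2 * δ * (Real.sinc (l * δ) * (z.re * Real.cos (l * t) - z.im * Real.sin (l * t))) := by
  have hd : ∀ s : ℝ, HasDerivAt (fun s => (z.re * Real.sin (l * (t + s)) +
      z.im * Real.cos (l * (t + s))) / l)
      (z.re * Real.cos (l * (t + s)) - z.im * Real.sin (l * (t + s))) s := by
    intro s
    have ha : HasDerivAt (fun s : ℝ => l * (t + s)) l s := by
      simpa using ((hasDerivAt_id s).const_add t).const_mul l
    refine (((ha.sin.const_mul z.re).add (ha.cos.const_mul z.im)).div_const l).congr_deriv ?_
    field_simp
    ring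
  rw [intervalIntegral.integral_eq_sub_of_hasDerivAt (fun t _ => hd t)
    (Continuous.intervalIntegrable (by fun_prop) _ _),
    Real.sinc_of_ne_zero (mul_ne_zero hl hδ)]
  simp only [mul_add, mul_neg, Real.sin_add, Real.cos_add, Real.sin_neg, Real.cos_neg]
  field_simp
  ring

theorem integral_trigSum_add {ω : ℕ → ℝ} (hω : ∀ k, ω k ≠ 0) {δ : ℝ} (hδ : δ ≠ 0)
    (F : Finset ℕ) (z : ℕ → ℂ) (t : ℝ) :
    ∫ s in (-δ)..δ, trigSum ω F z (t + s) =
      2 * δ * trigSum ω F (fun k => (Real.sinc (ω k * δ) : ℂ) * z k) t := by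
  unfold trigSum
  rw [intervalIntegral.integral_finsetSum fun k _ =>
    Continuous.intervalIntegrable (by fun_prop) _ _, Finset.mul_sum]
  refine Finset.sum_congr rfl fun k _ => ?_
  rw [integral_mode_add (z k) (hω k) hδ, Complex.re_ofReal_mul, Complex.im_ofReal_mul]
  ring

theorem exists_le_sinc_sub {ω : ℕ → ℝ} (hω : StrictMono ω) (hω0 : 0 < ω 0)
    (htop : Tendsto ω atTop atTop) {δ : ℝ} (hδ : 0 < δ) (hδ' : ω 0 * δ ≤ Real.pi / 2) :
    ∃ c : ℝ, 0 < c ∧ ∀ k, 1 ≤ k → c ≤ Real.sinc (ω 0 * δ) - Real.sinc (ω k * δ) := by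
  have hpos : ∀ k, 1 ≤ k → 0 < Real.sinc (ω 0 * δ) - Real.sinc (ω k * δ) := fun k hk =>
    sub_pos.2 (sinc_lt_sinc (by positivity) hδ' (mul_lt_mul_of_pos_right (hω (by omega)) hδ))
  have hS0 : 0 < Real.sinc (ω 0 * δ) := by
    rw [Real.sinc_of_ne_zero (by positivity)]
    have := Real.sin_pos_of_pos_of_lt_pi (x := ω 0 * δ) (by positivity)
      (by linarith [Real.pi_pos])
    positivity
  have hlim : Tendsto (fun k => Real.sinc (ω (k + 1) * δ)) atTop (𝓝 0) := by
    have htop' : Tendsto (fun k => ω (k + 1) * δ) atTop atTop :=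
      ((tendsto_add_atTop_iff_nat 1).2 htop).atTop_mul_const hδ
    refine squeeze_zero_norm' (a := fun k => (ω (k + 1) * δ)⁻¹) ?_ htop'.inv_tendsto_atTop
    refine Eventually.of_forall fun k => ?_
    have hk : 0 < ω (k + 1) * δ := mul_pos (hω0.trans (hω (by omega))) hδ
    rw [Real.sinc_of_ne_zero hk.ne', norm_div, Real.norm_eq_abs, Real.norm_of_nonneg hk.le,
      ← one_div]
    gcongr
    exact Real.abs_sin_le_one _
  -- The positive differences converge to the positive limit `sinc (ω₀ δ)`; their inverses therefore
  -- converge and are bounded, which gives a uniform lower bound.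
  have hinv : Tendsto (fun k => (Real.sinc (ω 0 * δ) - Real.sinc (ω (k + 1) * δ))⁻¹) atTop
      (𝓝 (Real.sinc (ω 0 * δ) - 0)⁻¹) :=
    (tendsto_const_nhds.sub hlim).inv₀ (by rw [sub_zero]; exact hS0.ne')
  obtain ⟨K, hK⟩ := hinv.bddAbove_range
  have hK' : ∀ k, (Real.sinc (ω 0 * δ) - Real.sinc (ω (k + 1) * δ))⁻¹ ≤ K := fun k =>
    hK (Set.mem_range_self k)
  have hK0 : 0 < K := (inv_pos.2 (hpos 1 le_rfl)).trans_le (hK' 0)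
  refine ⟨K⁻¹, inv_pos.2 hK0, fun k hk => ?_⟩
  obtain ⟨m, rfl⟩ := Nat.exists_eq_add_of_le' hk
  rw [inv_le_comm₀ hK0 (hpos _ hk)]
  exact hK' m

theorem exists_le_integral_mode_sq {l R : ℝ} (hl : 0 < l) (hR : 0 < R) :
    ∃ c : ℝ, 0 < c ∧ ∀ z : ℂ, c * ‖z‖ ^ 2 ≤
      ∫ t in (-R)..R, (z.re * Real.cos (l * t) - z.im * Real.sin (l * t)) ^ 2 := by
  have hlt : |Real.sin (2 * l * R)| < 2 * l * R := by
    refine abs_lt.2 ⟨?_, Real.sin_lt (by positivity)⟩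
    have h0 : 0 < 2 * l * R := by positivity
    rcases lt_or_ge (2 * l * R) Real.pi with h | h
    · linarith [Real.sin_pos_of_pos_of_lt_pi h0 h]
    · linarith [Real.neg_one_le_sin (2 * l * R), Real.pi_gt_three]
  -- The square is its mean `‖z‖²/2` plus an oscillation of frequency `2l`. The even cosine part
  -- cancels between `±R`, leaving the constant `R - |sin (2lR)|/(2l)`.
  have hd : ∀ (z : ℂ) (t : ℝ), HasDerivAt (fun t => ‖z‖ ^ 2 / 2 * t +
      ((z.re ^ 2 - z.im ^ 2) * Real.sin (2 * l * t) + 2 * z.re * z.im * Real.cos (2 * l * t)) /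
        (4 * l)) ((z.re * Real.cos (l * t) - z.im * Real.sin (l * t)) ^ 2) t := by
    intro z t
    have ha : HasDerivAt (fun t : ℝ => 2 * l * t) (2 * l) t := by
      simpa using (hasDerivAt_id t).const_mul (2 * l)
    refine (((hasDerivAt_id t).const_mul (‖z‖ ^ 2 / 2)).add
      (((ha.sin.const_mul (z.re ^ 2 - z.im ^ 2)).add
        (ha.cos.const_mul (2 * z.re * z.im))).div_const (4 * l))).congr_deriv ?_
    rw [← Complex.normSq_eq_norm_sq, Complex.normSq_apply, mul_assoc 2 l t, Real.sin_two_mul,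
      Real.cos_two_mul]
    field_simp
    linear_combination (-8 * z.im ^ 2) * Real.sin_sq_add_cos_sq (l * t)
  refine ⟨R - |Real.sin (2 * l * R)| / (2 * l), ?_, fun z => ?_⟩
  · rw [sub_pos, div_lt_iff₀ (by positivity)]
    linarith
  · rw [intervalIntegral.integral_eq_sub_of_hasDerivAt (fun t _ => hd z t)
      (Continuous.intervalIntegrable (by fun_prop) _ _)]
    simp only [mul_neg, Real.sin_neg, Real.cos_neg]
    have h1 : |(z.re ^ 2 - z.im ^ 2) * Real.sin (2 * l * R)| ≤
        ‖z‖ ^ 2 * |Real.sin (2 * l * R)| := by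
      rw [abs_mul]
      gcongr
      rw [← Complex.normSq_eq_norm_sq, Complex.normSq_apply]
      exact abs_le.2 ⟨by nlinarith [sq_nonneg z.re], by nlinarith [sq_nonneg z.im]⟩
    have h2 := (abs_le.1 h1).1
    have h3 : -(‖z‖ ^ 2 * |Real.sin (2 * l * R)|) / (2 * l) ≤
        (z.re ^ 2 - z.im ^ 2) * Real.sin (2 * l * R) / (2 * l) := by gcongr
    calc (R - |Real.sin (2 * l * R)| / (2 * l)) * ‖z‖ ^ 2
        = R * ‖z‖ ^ 2 + -(‖z‖ ^ 2 * |Real.sin (2 * l * R)|) / (2 * l) := by ring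
      _ ≤ R * ‖z‖ ^ 2 + (z.re ^ 2 - z.im ^ 2) * Real.sin (2 * l * R) / (2 * l) := by gcongr
      _ = _ := by field_simp; ring

theorem gap_le {ω : ℕ → ℝ} {γ : ℝ} (hgap : ∀ k, γ ≤ ω (k + 1) - ω k) {j k : ℕ} (hjk : j ≤ k) :
    (k - j : ℕ) * γ ≤ ω k - ω j := by
  obtain ⟨d, rfl⟩ := Nat.exists_eq_add_of_le hjk
  rw [Nat.add_sub_cancel_left]
  induction d with
  | zero => simp
  | succ d ih =>
    have := hgap (j + d)
    have := ih (by omega)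
    push_cast
    rw [← add_assoc]
    linarith

theorem mul_le_freq {ω : ℕ → ℝ} {γ : ℝ} (hω0 : 0 < ω 0) (hgap : ∀ k, γ ≤ ω (k + 1) - ω k)
    (k : ℕ) : k * γ ≤ ω k := by
  have := gap_le hgap (Nat.zero_le k)
  rw [Nat.sub_zero] at this
  linarith

theorem integral_trigSum_sq_le {ω : ℕ → ℝ} {γ : ℝ} (hγ : 0 < γ) (hω0 : 0 < ω 0)
    (hgap : ∀ k, γ ≤ ω (k + 1) - ω k) {R : ℝ} (hR : 0 ≤ R) :
    ∃ C : ℝ, 0 ≤ C ∧ ∀ F : Finset ℕ, 0 ∈ F → ∀ z : ℕ → ℂ,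
      ∫ t in (-R)..R, trigSum ω F z t ^ 2 ≤ C * ∑ k ∈ F, ‖z k‖ ^ 2 := by
  obtain ⟨C, hC0, hC⟩ := integral_trigSum_sq_le_of_one_le hγ (fun _ _ => gap_le hgap)
    (mul_le_freq hω0 hgap) hR
  refine ⟨4 * R + 2 * C, by positivity, fun F hF z => ?_⟩
  have h1 := hC (F.erase 0) (fun k hk => by have := Finset.ne_of_mem_erase hk; omega) z
  rw [← Finset.add_sum_erase F _ hF]
  have h2 : ∫ t in (-R)..R, trigSum ω F z t ^ 2 ≤
      ∫ t in (-R)..R, (2 * ‖z 0‖ ^ 2 + 2 * trigSum ω (F.erase 0) z t ^ 2) := by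
    refine intervalIntegral.integral_mono_on (by linarith)
      (Continuous.intervalIntegrable (by fun_prop) _ _)
      (Continuous.intervalIntegrable (by fun_prop) _ _) fun t _ => ?_
    rw [trigSum_eq_add_erase ω hF]
    have h3 := mode_sq_le (z 0) (ω 0 * t)
    generalize (z 0).re * Real.cos (ω 0 * t) - (z 0).im * Real.sin (ω 0 * t) = x at h3
    nlinarith [sq_nonneg (x - trigSum ω (F.erase 0) z t)]
  rw [intervalIntegral.integral_add (Continuous.intervalIntegrable (by fun_prop) _ _)
    (Continuous.intervalIntegrable (by fun_prop) _ _), intervalIntegral.integral_const,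
    intervalIntegral.integral_const_mul, smul_eq_mul] at h2
  have h3 : 0 ≤ ∑ k ∈ F.erase 0, ‖z k‖ ^ 2 := by positivity
  have h4 : 0 ≤ ‖z 0‖ ^ 2 := by positivity
  nlinarith [mul_nonneg hR h3, mul_nonneg hC0 h4]

/-- Removing the lowest mode by an averaging operator costs only a multiple of the `L²` norm on a
slightly larger interval. -/
theorem integral_trigSum_erase_sq_le {ω : ℕ → ℝ} (hω : ∀ k, ω k ≠ 0) {δ R : ℝ} (hδ : 0 < δ)
    (hδR : δ ≤ R) (F : Finset ℕ) (hF : 0 ∈ F) (z : ℕ → ℂ) :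
    ∫ t in (-(R - δ))..(R - δ), trigSum ω (F.erase 0)
        (fun k => ((Real.sinc (ω 0 * δ) - Real.sinc (ω k * δ) : ℝ) : ℂ) * z k) t ^ 2 ≤
      (2 + 2 * R / δ) * ∫ t in (-R)..R, trigSum ω F z t ^ 2 := by
  set J := ∫ t in (-R)..R, trigSum ω F z t ^ 2 with hJ
  set S := Real.sinc (ω 0 * δ)
  have hS : S ^ 2 ≤ 1 := by
    rw [sq_le_one_iff_abs_le_one]; exact Real.abs_sinc_le_one _
  have hJ0 : 0 ≤ J := intervalIntegral.integral_nonneg (by linarith) fun _ _ => sq_nonneg _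
  have hptw : ∀ t ∈ Icc (-(R - δ)) (R - δ), trigSum ω (F.erase 0)
      (fun k => ((S - Real.sinc (ω k * δ) : ℝ) : ℂ) * z k) t ^ 2 ≤
      2 * trigSum ω F z t ^ 2 + J / δ := by
    intro t ht
    -- The operator `S · id - average` multiplies mode `k` by `S - sinc (ωₖ δ)`, which vanishes at
    -- `k = 0`.
    have h1 : trigSum ω (F.erase 0) (fun k => ((S - Real.sinc (ω k * δ) : ℝ) : ℂ) * z k) t =
        S * trigSum ω F z t - trigSum ω F (fun k => (Real.sinc (ω k * δ) : ℂ) * z k) t := by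
      have := trigSum_eq_add_erase ω hF
        (fun k => ((S - Real.sinc (ω k * δ) : ℝ) : ℂ) * z k) t
      simp only [S, sub_self, Complex.ofReal_zero, zero_mul, Complex.zero_re, Complex.zero_im,
        zero_add] at this
      rw [← this, trigSum, trigSum, trigSum, Finset.mul_sum, ← Finset.sum_sub_distrib]
      refine Finset.sum_congr rfl fun k _ => ?_
      simp only [Complex.re_ofReal_mul, Complex.im_ofReal_mul]
      ring
    have h2 : (2 * δ * trigSum ω F (fun k => (Real.sinc (ω k * δ) : ℂ) * z k) t) ^ 2 ≤
        2 * δ * J := by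
      rw [← integral_trigSum_add hω hδ.ne']
      refine (sq_integral_le (by fun_prop) hδ).trans ?_
      gcongr
      rw [intervalIntegral.integral_comp_add_left (fun s => trigSum ω F z s ^ 2)]
      refine intervalIntegral.integral_mono_interval (by linarith [ht.1]) (by linarith)
        (by linarith [ht.2]) (Eventually.of_forall fun _ => sq_nonneg _)
        (Continuous.intervalIntegrable (by fun_prop) _ _)
    rw [h1]
    set A := trigSum ω F (fun k => (Real.sinc (ω k * δ) : ℂ) * z k) t
    set f := trigSum ω F z t
    have h3 : 2 * A ^ 2 ≤ J / δ := by
      rw [le_div_iff₀ hδ]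
      have : 2 * δ * (2 * A ^ 2 * δ) ≤ 2 * δ * J := by linarith
      exact le_of_mul_le_mul_left this (by positivity)
    nlinarith [sq_nonneg (S * f + A), mul_le_mul_of_nonneg_right hS (sq_nonneg f)]
  have h1 := intervalIntegral.integral_mono_on (μ := volume) (by linarith)
    (Continuous.intervalIntegrable (by fun_prop) _ _)
    (Continuous.intervalIntegrable (by fun_prop) _ _) hptw
  refine h1.trans ?_
  rw [intervalIntegral.integral_add (Continuous.intervalIntegrable (by fun_prop) _ _)
    (Continuous.intervalIntegrable (by fun_prop) _ _), intervalIntegral.integral_const,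
    intervalIntegral.integral_const_mul, smul_eq_mul]
  have h2 : ∫ t in (-(R - δ))..(R - δ), trigSum ω F z t ^ 2 ≤ J :=
    intervalIntegral.integral_mono_interval (by linarith) (by linarith) (by linarith)
      (Eventually.of_forall fun _ => sq_nonneg _) (Continuous.intervalIntegrable (by fun_prop) _ _)
  have h3 : (R - δ - -(R - δ)) * (J / δ) ≤ 2 * R / δ * J := by
    have : 2 * R / δ * J = (2 * R) * (J / δ) := by ring
    rw [this]
    gcongr
    linarith
  linarith

/-- Ingham's inequality for `∑ Re (zₖ e^{i ωₖ t})`; the gap between `-ω₀` and `ω₀` is not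
required to be large. -/
theorem le_integral_trigSum_sq {ω : ℕ → ℝ} {γ : ℝ} (hγ : 0 < γ) (hω0 : 0 < ω 0)
    (hgap : ∀ k, γ ≤ ω (k + 1) - ω k) {R : ℝ} (hR : Real.pi / γ < R) :
    ∃ c : ℝ, 0 < c ∧ ∀ F : Finset ℕ, 0 ∈ F → ∀ z : ℕ → ℂ,
      c * ∑ k ∈ F, ‖z k‖ ^ 2 ≤ ∫ t in (-R)..R, trigSum ω F z t ^ 2 := by
  have hπ := Real.pi_pos
  have hR0 : 0 < R := lt_trans (by positivity) hR
  have hmono : StrictMono ω := strictMono_nat_of_lt_succ fun k => by linarith [hgap k]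
  have hpos : ∀ k, 0 < ω k := fun k => hω0.trans_le (hmono.monotone (Nat.zero_le k))
  have htop : Tendsto ω atTop atTop :=
    tendsto_atTop_mono (mul_le_freq hω0 hgap) (tendsto_natCast_atTop_atTop.atTop_mul_const hγ)
  -- The first bound keeps `R - δ > π/γ`, so the lower estimate for `k ≥ 1` applies on the shortened
  -- interval; the second makes `sinc` at `ω₀ δ` exceed its value at every later frequency.
  set δ := min ((R - Real.pi / γ) / 2) (Real.pi / 2 / ω 0) with hδdef
  have hδ : 0 < δ := lt_min (by linarith) (by positivity)
  have hδ1 : δ ≤ (R - Real.pi / γ) / 2 := min_le_left _ _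
  have hδ2 : ω 0 * δ ≤ Real.pi / 2 := by
    have := min_le_right ((R - Real.pi / γ) / 2) (Real.pi / 2 / ω 0)
    rw [← hδdef, le_div_iff₀ hω0] at this
    linarith
  have hpγ : 0 < Real.pi / γ := by positivity
  obtain ⟨c₁, hc₁, hS⟩ := exists_le_sinc_sub hmono hω0 htop hδ hδ2
  obtain ⟨c₂, hc₂, hlow⟩ := le_integral_trigSum_sq_of_one_le hγ (fun _ _ => gap_le hgap)
    (mul_le_freq hω0 hgap) (R := R - δ) (by linarith)
  obtain ⟨C, hC0, hC⟩ := integral_trigSum_sq_le_of_one_le hγ (fun _ _ => gap_le hgap)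
    (mul_le_freq hω0 hgap) hR0.le
  obtain ⟨c₃, hc₃, hmode⟩ := exists_le_integral_mode_sq hω0 hR0
  set K := (2 + 2 * R / δ) / (c₂ * c₁ ^ 2) with hK
  have hK0 : 0 < K := by positivity
  set K' := (2 + 2 * C * K) / c₃ + K with hK'
  have hK'0 : 0 < K' := by positivity
  refine ⟨K'⁻¹, inv_pos.2 hK'0, fun F hF z => ?_⟩
  have hF1 : ∀ k ∈ F.erase 0, 1 ≤ k := fun k hk => by
    have := Finset.ne_of_mem_erase hk; omega
  set J := ∫ t in (-R)..R, trigSum ω F z t ^ 2 with hJ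
  have hJ0 : 0 ≤ J := intervalIntegral.integral_nonneg (by linarith) fun _ _ => sq_nonneg _
  have htail : ∑ k ∈ F.erase 0, ‖z k‖ ^ 2 ≤ K * J := by
    have h1 := (hlow _ hF1 _).trans (integral_trigSum_erase_sq_le (fun k => (hpos k).ne') hδ
      (by linarith) F hF z)
    have h2 : c₁ ^ 2 * ∑ k ∈ F.erase 0, ‖z k‖ ^ 2 ≤ ∑ k ∈ F.erase 0,
        ‖((Real.sinc (ω 0 * δ) - Real.sinc (ω k * δ) : ℝ) : ℂ) * z k‖ ^ 2 := by
      rw [Finset.mul_sum]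
      refine Finset.sum_le_sum fun k hk => ?_
      rw [norm_mul, Complex.norm_real, Real.norm_eq_abs, mul_pow]
      gcongr
      exact (hS k (hF1 k hk)).trans (le_abs_self _)
    rw [hK, div_mul_eq_mul_div, le_div_iff₀ (by positivity)]
    nlinarith [mul_le_mul_of_nonneg_left h2 hc₂.le]
  -- The mode `0` is the full sum minus the tail; the tail is controlled in `L²` by the upper
  -- estimate and `htail`.
  have hhead : c₃ * ‖z 0‖ ^ 2 ≤ (2 + 2 * C * K) * J := by
    refine (hmode (z 0)).trans ?_
    have h1 : ∫ t in (-R)..R, ((z 0).re * Real.cos (ω 0 * t) - (z 0).im * Real.sin (ω 0 * t)) ^ 2 ≤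
        ∫ t in (-R)..R, (2 * trigSum ω F z t ^ 2 + 2 * trigSum ω (F.erase 0) z t ^ 2) := by
      refine intervalIntegral.integral_mono_on (by linarith)
        (Continuous.intervalIntegrable (by fun_prop) _ _)
        (Continuous.intervalIntegrable (by fun_prop) _ _) fun t _ => ?_
      rw [trigSum_eq_add_erase ω hF]
      generalize (z 0).re * Real.cos (ω 0 * t) - (z 0).im * Real.sin (ω 0 * t) = x
      nlinarith [sq_nonneg (x + 2 * trigSum ω (F.erase 0) z t)]
    rw [intervalIntegral.integral_add (Continuous.intervalIntegrable (by fun_prop) _ _)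
      (Continuous.intervalIntegrable (by fun_prop) _ _),
      intervalIntegral.integral_const_mul, intervalIntegral.integral_const_mul] at h1
    nlinarith [hC _ hF1 z, mul_le_mul_of_nonneg_left htail hC0]
  rw [inv_mul_le_iff₀ hK'0, ← Finset.add_sum_erase F _ hF, hK', add_mul]
  refine add_le_add ?_ htail
  rw [div_mul_eq_mul_div, le_div_iff₀ hc₃]
  linarith

/-! ### Transfer from `[-T/2, T/2]` to `[0, T]`: a time shift multiplies each `zₖ` by a phase. -/

theorem trigSum_add (ω : ℕ → ℝ) (F : Finset ℕ) (z : ℕ → ℂ) (t r : ℝ) :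
    trigSum ω F z (t + r) =
      trigSum ω F (fun k => z k * Complex.exp ((ω k * r : ℝ) * Complex.I)) t := by
  refine Finset.sum_congr rfl fun k _ => ?_
  rw [Complex.mul_re, Complex.mul_im, Complex.exp_ofReal_mul_I_re, Complex.exp_ofReal_mul_I_im,
    mul_add, Real.cos_add, Real.sin_add]
  ring

theorem integral_trigSum_sq_eq (ω : ℕ → ℝ) (F : Finset ℕ) (z : ℕ → ℂ) (T : ℝ) :
    ∫ t in (0 : ℝ)..T, trigSum ω F z t ^ 2 = ∫ t in (-(T / 2))..(T / 2), trigSum ω F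
      (fun k => z k * Complex.exp ((ω k * (T / 2) : ℝ) * Complex.I)) t ^ 2 := by
  simp only [← trigSum_add]
  rw [intervalIntegral.integral_comp_add_right (fun t => trigSum ω F z t ^ 2)]
  simp

theorem integral_zero_trigSum_sq_le {ω : ℕ → ℝ} {γ : ℝ} (hγ : 0 < γ) (hω0 : 0 < ω 0)
    (hgap : ∀ k, γ ≤ ω (k + 1) - ω k) {T : ℝ} (hT : 0 ≤ T) :
    ∃ C : ℝ, 0 ≤ C ∧ ∀ F : Finset ℕ, 0 ∈ F → ∀ z : ℕ → ℂ,
      ∫ t in (0 : ℝ)..T, trigSum ω F z t ^ 2 ≤ C * ∑ k ∈ F, ‖z k‖ ^ 2 := by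
  obtain ⟨C, hC0, hC⟩ := integral_trigSum_sq_le hγ hω0 hgap (R := T / 2) (by linarith)
  refine ⟨C, hC0, fun F hF z => ?_⟩
  rw [integral_trigSum_sq_eq]
  simpa only [norm_mul, Complex.norm_exp_ofReal_mul_I, mul_one] using
    hC F hF (fun k => z k * Complex.exp ((ω k * (T / 2) : ℝ) * Complex.I))

theorem le_integral_zero_trigSum_sq {ω : ℕ → ℝ} {γ : ℝ} (hγ : 0 < γ) (hω0 : 0 < ω 0)
    (hgap : ∀ k, γ ≤ ω (k + 1) - ω k) {T : ℝ} (hT : 2 * Real.pi / γ < T) :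
    ∃ c : ℝ, 0 < c ∧ ∀ F : Finset ℕ, 0 ∈ F → ∀ z : ℕ → ℂ,
      c * ∑ k ∈ F, ‖z k‖ ^ 2 ≤ ∫ t in (0 : ℝ)..T, trigSum ω F z t ^ 2 := by
  obtain ⟨c, hc0, hc⟩ := le_integral_trigSum_sq hγ hω0 hgap (R := T / 2)
    (by rw [mul_div_assoc] at hT; linarith)
  refine ⟨c, hc0, fun F hF z => ?_⟩
  rw [integral_trigSum_sq_eq]
  simpa only [norm_mul, Complex.norm_exp_ofReal_mul_I, mul_one] using
    hc F hF (fun k => z k * Complex.exp ((ω k * (T / 2) : ℝ) * Complex.I))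

/-! ### The abstract moment problem in a Hilbert space. -/

/-- The complex sequence space `ℓ²(ℂ)`. -/
abbrev EllTwoC : Type := lp (fun _ : ℕ => ℂ) 2

theorem hasSum_norm_sq (y : EllTwoC) : HasSum (fun k => ‖y k‖ ^ 2) (‖y‖ ^ 2) := by
  have := lp.hasSum_norm (p := 2) (by norm_num) y
  simpa using this

theorem memℓp_of_sum_range_le {f : ℕ → ℂ} {C : ℝ}
    (h : ∀ N, ∑ k ∈ Finset.range N, ‖f k‖ ^ 2 ≤ C) : Memℓp f 2 := by
  refine memℓp_gen ?_
  simpa using summable_of_sum_range_le (fun k => sq_nonneg ‖f k‖) h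

theorem norm_sq_le_of_sum_range_le {y : EllTwoC} {C : ℝ}
    (h : ∀ N, ∑ k ∈ Finset.range N, ‖y k‖ ^ 2 ≤ C) : ‖y‖ ^ 2 ≤ C :=
  le_of_tendsto' (hasSum_norm_sq y).tendsto_sum_nat h

section Moment

variable {E : Type*} [NormedAddCommGroup E] [InnerProductSpace ℝ E] {p q : ℕ → E} {C : ℝ}

/-- Duality: with the moments of `u` themselves as coefficients, their square sum `s` equals `⟪v,
u⟫`, so `s² ≤ C s ‖u‖²`. -/
theorem bessel (hC0 : 0 ≤ C) (hC : ∀ (N : ℕ) (z : ℕ → ℂ),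
      ‖∑ k ∈ Finset.range N, ((z k).re • p k + (z k).im • q k)‖ ^ 2 ≤
        C * ∑ k ∈ Finset.range N, ‖z k‖ ^ 2) (u : E) (N : ℕ) :
    ∑ k ∈ Finset.range N, ‖(⟨inner ℝ (p k) u, inner ℝ (q k) u⟩ : ℂ)‖ ^ 2 ≤ C * ‖u‖ ^ 2 := by
  set z : ℕ → ℂ := fun k => ⟨inner ℝ (p k) u, inner ℝ (q k) u⟩ with hz
  set s := ∑ k ∈ Finset.range N, ‖z k‖ ^ 2 with hs
  set v := ∑ k ∈ Finset.range N, ((z k).re • p k + (z k).im • q k) with hv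
  have h1 : s = inner ℝ v u := by
    rw [hv, sum_inner]
    refine Finset.sum_congr rfl fun k _ => ?_
    rw [inner_add_left, real_inner_smul_left, real_inner_smul_left,
      ← Complex.normSq_eq_norm_sq, Complex.normSq_apply]
  have h2 : s ≤ ‖v‖ * ‖u‖ := h1 ▸ real_inner_le_norm v u
  have h3 : ‖v‖ ^ 2 ≤ C * s := hC N z
  have hs0 : 0 ≤ s := by positivity
  rcases hs0.eq_or_lt with h | h
  · rw [← h]
    positivity
  · have h4 : s ^ 2 ≤ (C * s) * ‖u‖ ^ 2 := by
      calc s ^ 2 ≤ (‖v‖ * ‖u‖) ^ 2 := by gcongr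
        _ = ‖v‖ ^ 2 * ‖u‖ ^ 2 := by ring
        _ ≤ _ := by gcongr
    nlinarith

/-- The moment operator `u ↦ (⟪pₖ, u⟫ + i ⟪qₖ, u⟫)ₖ` of a Bessel family. -/
noncomputable def moment (hC0 : 0 ≤ C) (hC : ∀ (N : ℕ) (z : ℕ → ℂ),
      ‖∑ k ∈ Finset.range N, ((z k).re • p k + (z k).im • q k)‖ ^ 2 ≤
        C * ∑ k ∈ Finset.range N, ‖z k‖ ^ 2) : E →L[ℝ] EllTwoC :=
  LinearMap.mkContinuous
    { toFun := fun u => ⟨fun k => ⟨inner ℝ (p k) u, inner ℝ (q k) u⟩,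
        memℓp_of_sum_range_le (bessel hC0 hC u)⟩
      map_add' := fun u v => lp.ext (funext fun k => Complex.ext
        (inner_add_right _ _ _) (inner_add_right _ _ _))
      map_smul' := fun r u => lp.ext (funext fun k => Complex.ext
        (by simp [inner_smul_right]) (by simp [inner_smul_right])) }
    (Real.sqrt C) fun u => by
      refine le_of_sq_le_sq ?_ (by positivity)
      rw [mul_pow, Real.sq_sqrt hC0]
      exact norm_sq_le_of_sum_range_le (bessel hC0 hC u)

theorem moment_apply (hC0 : 0 ≤ C) (hC : ∀ (N : ℕ) (z : ℕ → ℂ),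
      ‖∑ k ∈ Finset.range N, ((z k).re • p k + (z k).im • q k)‖ ^ 2 ≤
        C * ∑ k ∈ Finset.range N, ‖z k‖ ^ 2) (u : E) (k : ℕ) :
    moment hC0 hC u k = ⟨inner ℝ (p k) u, inner ℝ (q k) u⟩ := rfl

/-- The adjoint `S` of the moment map `M` is the synthesis map, bounded below by hypothesis. Hence
`M S` is coercive, Lax–Milgram makes it invertible, and `u = S v` solves the problem. -/
theorem exists_moment_eq [CompleteSpace E] (hC0 : 0 ≤ C) (hC : ∀ (N : ℕ) (z : ℕ → ℂ),
      ‖∑ k ∈ Finset.range N, ((z k).re • p k + (z k).im • q k)‖ ^ 2 ≤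
        C * ∑ k ∈ Finset.range N, ‖z k‖ ^ 2) {c : ℝ} (hc0 : 0 < c)
    (hc : ∀ (N : ℕ) (z : ℕ → ℂ), c * ∑ k ∈ Finset.range N, ‖z k‖ ^ 2 ≤
      ‖∑ k ∈ Finset.range N, ((z k).re • p k + (z k).im • q k)‖ ^ 2) (y : EllTwoC) :
    ∃ u : E, ∀ k, (⟨inner ℝ (p k) u, inner ℝ (q k) u⟩ : ℂ) = y k := by
  set M := moment hC0 hC
  set S : EllTwoC →L[ℝ] E := ContinuousLinearMap.adjoint M
  have hsingle : ∀ k w, S (lp.single 2 k w) = w.re • p k + w.im • q k := by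
    intro k w
    refine ext_inner_right ℝ fun u => ?_
    rw [ContinuousLinearMap.adjoint_inner_left, lp.inner_single_left, inner_add_left,
      real_inner_smul_left, real_inner_smul_left, Complex.inner]
    rw [moment_apply]
    simp
    ring
  have hlow : ∀ y, c * ‖y‖ ^ 2 ≤ ‖S y‖ ^ 2 := by
    intro y
    have h1 := (lp.hasSum_single (p := 2) (by norm_num) y).tendsto_sum_nat
    have h2 := ((S.continuous.tendsto _).comp h1).norm.pow 2
    have h3 := (hasSum_norm_sq y).tendsto_sum_nat.const_mul c
    refine le_of_tendsto_of_tendsto' h3 h2 fun N => ?_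
    simp only [Function.comp_apply, map_sum, hsingle]
    exact hc N y
  let B : EllTwoC →L[ℝ] EllTwoC →L[ℝ] ℝ := (innerSL ℝ).comp (M.comp S)
  have hB : ∀ v w, B v w = inner ℝ (M (S v)) w := fun v w => rfl
  have hcoer : IsCoercive B := ⟨c, hc0, fun v => by
    rw [hB, ← ContinuousLinearMap.adjoint_inner_right, real_inner_self_eq_norm_sq]
    have := hlow v
    nlinarith⟩
  obtain ⟨v, hv⟩ := hcoer.continuousLinearEquivOfBilin.surjective y
  have hMv : M (S v) = y := by
    refine ext_inner_right ℝ fun w => ?_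
    rw [← hB, ← hv, hcoer.continuousLinearEquivOfBilin_apply]
  exact ⟨S v, fun k => congrArg (fun f : EllTwoC => f k) hMv⟩

end Moment

/-! ### Controls in `L²` and their moments. -/

theorem memLp_two_restrict_Ioc {f : ℝ → ℝ} (hf : Continuous f) (a b : ℝ) :
    MemLp f 2 (volume.restrict (Ioc a b)) :=
  (memLp_two_iff_integrable_sq hf.aestronglyMeasurable).2 (hf.pow 2).integrableOn_Ioc

/-- Restriction of continuous functions to `L²(a, b)`. -/
noncomputable def restrictLp (a b : ℝ) : C(ℝ, ℝ) →ₗ[ℝ] Lp ℝ 2 (volume.restrict (Ioc a b)) where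
  toFun f := MemLp.toLp f (memLp_two_restrict_Ioc f.continuous a b)
  map_add' _ _ := MemLp.toLp_add _ _
  map_smul' _ _ := MemLp.toLp_const_smul _ _

theorem coeFn_restrictLp (a b : ℝ) (f : C(ℝ, ℝ)) :
    restrictLp a b f =ᵐ[volume.restrict (Ioc a b)] f :=
  MemLp.coeFn_toLp (memLp_two_restrict_Ioc f.continuous a b)

theorem inner_restrictLp {a b : ℝ} (hab : a ≤ b) (f : C(ℝ, ℝ))
    (u : Lp ℝ 2 (volume.restrict (Ioc a b))) :
    inner ℝ (restrictLp a b f) u = ∫ s in a..b, f s * u s := by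
  rw [L2.inner_def, intervalIntegral.integral_of_le hab]
  refine integral_congr_ae ?_
  filter_upwards [coeFn_restrictLp a b f] with s hs
  rw [hs]
  simp [mul_comm]

theorem norm_toLp_sq {a b : ℝ} (hab : a ≤ b) {u : ℝ → ℝ}
    (hu : MemLp u 2 (volume.restrict (Ioc a b))) :
    ‖hu.toLp u‖ ^ 2 = ∫ s in a..b, u s ^ 2 := by
  rw [← real_inner_self_eq_norm_sq, L2.inner_def, intervalIntegral.integral_of_le hab]
  refine integral_congr_ae ?_
  filter_upwards [hu.coeFn_toLp] with s hs
  rw [hs]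
  simp [sq]

/-- `cos (l t)` as a continuous function. -/
noncomputable def cosMap (l : ℝ) : C(ℝ, ℝ) := ⟨fun t => Real.cos (l * t), by fun_prop⟩

/-- `-sin (l t)` as a continuous function. -/
noncomputable def negSinMap (l : ℝ) : C(ℝ, ℝ) := ⟨fun t => -Real.sin (l * t), by fun_prop⟩

theorem norm_sum_restrictLp_sq {a b : ℝ} (hab : a ≤ b) (ω : ℕ → ℝ) (F : Finset ℕ) (z : ℕ → ℂ) :
    ‖∑ k ∈ F, ((z k).re • restrictLp a b (cosMap (ω k)) +
      (z k).im • restrictLp a b (negSinMap (ω k)))‖ ^ 2 = ∫ t in a..b, trigSum ω F z t ^ 2 := by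
  simp only [← map_smul, ← map_add, ← map_sum]
  have h : ∀ f : C(ℝ, ℝ), ‖restrictLp a b f‖ ^ 2 = ∫ s in a..b, f s ^ 2 := fun f =>
    norm_toLp_sq hab (memLp_two_restrict_Ioc f.continuous a b)
  rw [h]
  refine intervalIntegral.integral_congr fun t _ => ?_
  simp [trigSum, cosMap, negSinMap, sub_eq_add_neg]

section Control

variable {ω : ℕ → ℝ} {γ : ℝ}

/-- One constant serves all subintervals of `[0, T]`; this uniformity later yields continuity in
time. -/
theorem exists_bessel_const (hγ : 0 < γ) (hω0 : 0 < ω 0) (hgap : ∀ k, γ ≤ ω (k + 1) - ω k)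
    {T : ℝ} (hT : 0 ≤ T) : ∃ C : ℝ, 0 ≤ C ∧ ∀ a b, 0 ≤ a → a ≤ b → b ≤ T →
      ∀ (N : ℕ) (z : ℕ → ℂ),
      ‖∑ k ∈ Finset.range N, ((z k).re • restrictLp a b (cosMap (ω k)) +
        (z k).im • restrictLp a b (negSinMap (ω k)))‖ ^ 2 ≤
        C * ∑ k ∈ Finset.range N, ‖z k‖ ^ 2 := by
  obtain ⟨C, hC0, hC⟩ := integral_zero_trigSum_sq_le hγ hω0 hgap hT
  refine ⟨C, hC0, fun a b ha hab hb N z => ?_⟩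
  rw [norm_sum_restrictLp_sq hab]
  rcases N.eq_zero_or_pos with rfl | hN
  · simp [trigSum]
  · refine le_trans ?_ (hC _ (Finset.mem_range.2 hN) z)
    exact intervalIntegral.integral_mono_interval ha hab hb
      (Eventually.of_forall fun _ => sq_nonneg _) (Continuous.intervalIntegrable (by fun_prop) _ _)

/-- The moments `∫ₐᵇ u(s) e^{-i ωₖ s} ds` of a control. -/
noncomputable def moments (ω : ℕ → ℝ) (u : ℝ → ℝ) (a b : ℝ) (k : ℕ) : ℂ :=
  ⟨∫ s in a..b, Real.cos (ω k * s) * u s, ∫ s in a..b, -Real.sin (ω k * s) * u s⟩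

theorem moment_eq_moments {a b : ℝ} (hab : a ≤ b) (u : Lp ℝ 2 (volume.restrict (Ioc a b)))
    (k : ℕ) : (⟨inner ℝ (restrictLp a b (cosMap (ω k))) u,
      inner ℝ (restrictLp a b (negSinMap (ω k))) u⟩ : ℂ) = moments ω u a b k :=
  Complex.ext (inner_restrictLp hab _ _) (inner_restrictLp hab _ _)

theorem moments_congr {a b : ℝ} (hab : a ≤ b) {u v : ℝ → ℝ}
    (h : u =ᵐ[volume.restrict (Ioc a b)] v) (k : ℕ) : moments ω u a b k = moments ω v a b k := by
  unfold moments
  simp only [intervalIntegral.integral_of_le hab]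
  congr 1 <;> exact integral_congr_ae (h.mono fun s hs => by simp only [hs])

theorem exists_sum_moments_le (hγ : 0 < γ) (hω0 : 0 < ω 0) (hgap : ∀ k, γ ≤ ω (k + 1) - ω k)
    {T : ℝ} (hT : 0 ≤ T) : ∃ C : ℝ, 0 ≤ C ∧ ∀ u, IsControl T u → ∀ a b, 0 ≤ a → a ≤ b → b ≤ T →
      ∀ N, ∑ k ∈ Finset.range N, ‖moments ω u a b k‖ ^ 2 ≤ C * ∫ s in a..b, u s ^ 2 := by
  obtain ⟨C, hC0, hC⟩ := exists_bessel_const hγ hω0 hgap hT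
  refine ⟨C, hC0, fun u hu a b ha hab hb N => ?_⟩
  have hu' : MemLp u 2 (volume.restrict (Ioc a b)) :=
    hu.mono_measure (Measure.restrict_mono (Ioc_subset_Ioc ha hb) le_rfl)
  have h := bessel hC0 (hC a b ha hab hb) (hu'.toLp u) N
  simp only [moment_eq_moments hab, moments_congr hab hu'.coeFn_toLp] at h
  rwa [norm_toLp_sq hab hu'] at h

theorem exists_control_moments_eq (hγ : 0 < γ) (hω0 : 0 < ω 0)
    (hgap : ∀ k, γ ≤ ω (k + 1) - ω k) {T : ℝ} (hT : 2 * Real.pi / γ < T) (y : EllTwoC) :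
    ∃ u, IsControl T u ∧ ∀ k, moments ω u 0 T k = y k := by
  have hT0 : 0 ≤ T := le_trans (by have := Real.pi_pos; positivity) hT.le
  obtain ⟨C, hC0, hC⟩ := exists_bessel_const hγ hω0 hgap hT0
  obtain ⟨c, hc0, hc⟩ := le_integral_zero_trigSum_sq hγ hω0 hgap hT
  obtain ⟨u, hu⟩ := exists_moment_eq hC0 (hC 0 T le_rfl hT0 le_rfl) hc0 (fun N z => by
    rw [norm_sum_restrictLp_sq hT0]
    rcases N.eq_zero_or_pos with rfl | hN
    · simp [trigSum]
    · exact hc _ (Finset.mem_range.2 hN) z) y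
  exact ⟨u, Lp.memLp u, fun k => (moment_eq_moments hT0 u k).symm.trans (hu k)⟩

end Control

/-! ### Identification of `V b` with `ℓ²(ℂ)`. -/

theorem sq_mul_le (b : EllTwo) (k : ℕ) (x : ℝ) : (b k * x) ^ 2 ≤ ‖b‖ ^ 2 * x ^ 2 := by
  have h1 : |b k| ≤ ‖b‖ := lp.norm_apply_le_norm (by norm_num) b k
  rw [mul_pow, ← sq_abs (b k)]
  gcongr

theorem summable_norm_sq (y : EllTwoC) : Summable fun k => ‖y k‖ ^ 2 := (hasSum_norm_sq y).summable

theorem memℓp_mul {b : EllTwo} {f : ℕ → ℝ} (y : EllTwoC) (hf : ∀ k, |f k| ≤ ‖y k‖) :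
    Memℓp (fun k => b k * f k) 2 :=
  memℓp_two_of_sq_le ((summable_norm_sq y).mul_left (‖b‖ ^ 2)) fun k =>
    (sq_mul_le b k (f k)).trans (by rw [← sq_abs (f k)]; gcongr; exact hf k)

theorem state_norm_sq (x : State) : ‖x‖ ^ 2 = ∑' k, (x.fst k ^ 2 + x.snd k ^ 2) := by
  have h : ∀ ξ : EllTwo, ‖ξ‖ ^ 2 = ∑' k, ξ k ^ 2 := fun ξ => by
    have := lp.norm_rpow_eq_tsum (p := 2) (by norm_num) ξ
    simpa using this
  rw [WithLp.prod_norm_sq_eq_of_L2, (summable_sq x.fst).tsum_add (summable_sq x.snd), h, h]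

/-- The coordinates `ηₖ + i ξₖ = bₖ yₖ` of `V_{0,1}`. -/
noncomputable def embed (b : EllTwo) : EllTwoC →L[ℝ] State :=
  LinearMap.mkContinuous
    { toFun := fun y => WithLp.toLp 2
        (⟨fun k => b k * (y k).im, memℓp_mul y fun k => Complex.abs_im_le_norm _⟩,
         ⟨fun k => b k * (y k).re, memℓp_mul y fun k => Complex.abs_re_le_norm _⟩)
      map_add' := fun x y => state_ext fun k =>
        ⟨mul_add (b k) (x k).im (y k).im, mul_add (b k) (x k).re (y k).re⟩
      map_smul' := fun r y => state_ext fun k => by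
        constructor
        · change b k * (r • y k).im = r * (b k * (y k).im)
          rw [Complex.smul_im, smul_eq_mul]; ring
        · change b k * (r • y k).re = r * (b k * (y k).re)
          rw [Complex.smul_re, smul_eq_mul]; ring }
    ‖b‖ fun y => by
      refine le_of_sq_le_sq ?_ (by positivity)
      rw [state_norm_sq, mul_pow, ← (hasSum_norm_sq y).tsum_eq, ← tsum_mul_left]
      refine Summable.tsum_le_tsum (fun k => ?_) ((summable_sq _).add (summable_sq _))
        ((summable_norm_sq y).mul_left _)
      have h1 := sq_mul_le b k (y k).im
      have h2 := sq_mul_le b k (y k).re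
      change (b k * (y k).im) ^ 2 + (b k * (y k).re) ^ 2 ≤ _
      rw [← Complex.normSq_eq_norm_sq, Complex.normSq_apply]
      linarith

@[simp] theorem embed_fst (b : EllTwo) (y : EllTwoC) (k : ℕ) :
    (embed b y).fst k = b k * (y k).im := rfl

@[simp] theorem embed_snd (b : EllTwo) (y : EllTwoC) (k : ℕ) :
    (embed b y).snd k = b k * (y k).re := rfl

theorem embed_injective {b : EllTwo} (hb : ∀ k, b k ≠ 0) : Function.Injective (embed b) := by
  intro x y hxy
  refine lp.ext (funext fun k => Complex.ext ?_ ?_)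
  · have : (embed b x).snd k = (embed b y).snd k := by rw [hxy]
    exact mul_left_cancel₀ (hb k) this
  · have : (embed b x).fst k = (embed b y).fst k := by rw [hxy]
    exact mul_left_cancel₀ (hb k) this

theorem range_embed {b : EllTwo} (hb : ∀ k, b k ≠ 0) :
    Set.range (embed b) = (V b : Set State) := by
  have hn : ∀ (k : ℕ) (w : ℂ), ((b k * w.im) ^ 2 + (b k * w.re) ^ 2) / |b k| ^ 2 = ‖w‖ ^ 2 := by
    intro k w
    have := hb k
    rw [← Complex.normSq_eq_norm_sq, Complex.normSq_apply, sq_abs]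
    field_simp
    ring
  ext x
  constructor
  · rintro ⟨y, rfl⟩
    exact (summable_norm_sq y).congr fun k => (hn k (y k)).symm
  · intro hx
    have hx' : Summable fun k => (x.fst k ^ 2 + x.snd k ^ 2) / |b k| ^ 2 := hx
    have hy : Memℓp (fun k => (⟨x.snd k / b k, x.fst k / b k⟩ : ℂ)) 2 := by
      refine memℓp_gen ?_
      refine hx'.congr fun k => ?_
      have := hn k ⟨x.snd k / b k, x.fst k / b k⟩
      simp only [mul_div_cancel₀ _ (hb k)] at this
      rw [this]
      simp
    refine ⟨⟨_, hy⟩, state_ext fun k => ⟨?_, ?_⟩⟩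
    · exact mul_div_cancel₀ _ (hb k)
    · exact mul_div_cancel₀ _ (hb k)

theorem vInner_embed {b : EllTwo} (hb : ∀ k, b k ≠ 0) (x y : EllTwoC) :
    vInner b (embed b x) (embed b y) = inner ℝ x y := by
  rw [vInner, lp.inner_eq_tsum]
  refine tsum_congr fun k => ?_
  have := hb k
  rw [embed_fst, embed_snd, embed_fst, embed_snd, Complex.inner, sq_abs]
  simp
  field_simp
  ring

theorem vNorm_embed {b : EllTwo} (hb : ∀ k, b k ≠ 0) (y : EllTwoC) : vNorm b (embed b y) = ‖y‖ := by
  rw [vNorm, vInner_embed hb, real_inner_self_eq_norm_sq, Real.sqrt_sq (norm_nonneg _)]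

theorem isHilbertSubspaceWith_V {b : EllTwo} (hb : ∀ k, b k ≠ 0) :
    IsHilbertSubspaceWith (V b) (vInner b) :=
  ⟨EllTwoC, inferInstance, inferInstance, inferInstance, embed b, embed_injective hb,
    range_embed hb, fun x y => (vInner_embed hb x y).symm⟩

/-- The group `e^{tA}` in the coordinates of `embed`. -/
noncomputable def rotate (ω : ℕ → ℝ) (t : ℝ) (y : EllTwoC) : EllTwoC :=
  ⟨fun k => y k * Complex.exp ((ω k * t : ℝ) * Complex.I), memℓp_of_sum_range_le
    (C := ‖y‖ ^ 2) fun N => by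
      simp only [norm_mul, Complex.norm_exp_ofReal_mul_I, mul_one]
      exact (summable_norm_sq y).sum_le_tsum _ (fun _ _ => sq_nonneg _) |>.trans_eq
        (hasSum_norm_sq y).tsum_eq⟩

@[simp] theorem rotate_apply (ω : ℕ → ℝ) (t : ℝ) (y : EllTwoC) (k : ℕ) :
    rotate ω t y k = y k * Complex.exp ((ω k * t : ℝ) * Complex.I) := rfl

theorem norm_rotate (ω : ℕ → ℝ) (t : ℝ) (y : EllTwoC) : ‖rotate ω t y‖ = ‖y‖ := by
  have h : ‖rotate ω t y‖ ^ 2 = ‖y‖ ^ 2 := by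
    rw [← (hasSum_norm_sq y).tsum_eq, ← (hasSum_norm_sq _).tsum_eq]
    simp only [rotate_apply, norm_mul, Complex.norm_exp_ofReal_mul_I, mul_one]
  exact (sq_eq_sq₀ (norm_nonneg _) (norm_nonneg _)).1 h

theorem rotate_sub (ω : ℕ → ℝ) (t : ℝ) (x y : EllTwoC) :
    rotate ω t (x - y) = rotate ω t x - rotate ω t y :=
  lp.ext (funext fun k => sub_mul (x k) (y k) _)

theorem rotate_rotate_neg (ω : ℕ → ℝ) (t : ℝ) (y : EllTwoC) :
    rotate ω t (rotate ω (-t) y) = y :=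
  lp.ext (funext fun k => by
    rw [rotate_apply, rotate_apply, mul_assoc, ← Complex.exp_add]
    simp)

theorem continuous_rotate (ω : ℕ → ℝ) (y : EllTwoC) : Continuous fun t => rotate ω t y := by
  refine continuous_iff_continuousAt.2 fun t => ?_
  rw [ContinuousAt, tendsto_iff_norm_sub_tendsto_zero]
  have h1 : ∀ s, ‖rotate ω s y - rotate ω t y‖ =
      Real.sqrt (∑' k, ‖rotate ω s y k - rotate ω t y k‖ ^ 2) := fun s => by
    have := (hasSum_norm_sq (rotate ω s y - rotate ω t y)).tsum_eq
    rw [← Real.sqrt_sq (norm_nonneg (rotate ω s y - rotate ω t y)), ← this]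
    rfl
  have h2 : Tendsto (fun s => ∑' k, ‖rotate ω s y k - rotate ω t y k‖ ^ 2) (𝓝 t)
      (𝓝 (∑' _ : ℕ, (0 : ℝ))) := by
    refine tendsto_tsum_of_dominated_convergence ((summable_norm_sq y).mul_left 4)
      (fun k => ?_) (Eventually.of_forall fun s k => ?_)
    · have hc : Continuous fun s => ‖rotate ω s y k - rotate ω t y k‖ ^ 2 := by
        simp only [rotate_apply]
        fun_prop
      simpa using hc.tendsto t
    · rw [Real.norm_of_nonneg (sq_nonneg _)]
      have h3 : ‖rotate ω s y k - rotate ω t y k‖ ≤ 2 * ‖y k‖ := by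
        refine (norm_sub_le _ _).trans_eq ?_
        simp only [rotate_apply, norm_mul, Complex.norm_exp_ofReal_mul_I]
        ring
      calc _ ≤ (2 * ‖y k‖) ^ 2 := by gcongr
        _ = _ := by ring
  simp only [h1]
  simpa using h2.sqrt

theorem flow_embed (ω : ℕ → ℝ) (b : EllTwo) (t : ℝ) (y : EllTwoC) :
    flow ω t (embed b y) = embed b (rotate ω t y) :=
  state_ext fun k => by
    rw [flow_fst, flow_snd, embed_fst, embed_snd, embed_fst, embed_snd, rotate_apply,
      Complex.mul_re, Complex.mul_im, Complex.exp_ofReal_mul_I_re, Complex.exp_ofReal_mul_I_im]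
    constructor <;> ring

/-! ### The solution formula in the new coordinates. -/

theorem IsControl.integrableOn {T : ℝ} {u : ℝ → ℝ} (hu : IsControl T u) :
    IntegrableOn u (Ioc 0 T) :=
  hu.integrable one_le_two

theorem IsControl.intervalIntegrable {T : ℝ} {u : ℝ → ℝ} (hu : IsControl T u) {a b : ℝ}
    (ha : a ∈ Icc 0 T) (hb : b ∈ Icc 0 T) : IntervalIntegrable u volume a b :=
  intervalIntegrable_iff.2 (hu.integrableOn.mono_set
    (Ioc_subset_Ioc (le_min ha.1 hb.1) (max_le ha.2 hb.2)))

/-- In each coordinate `e^{i ωₖ (t - s)} = e^{i ωₖ t} e^{-i ωₖ s}`, so the rotation leaves the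
integral and the moment remains. Coordinate evaluations are continuous and linear, hence commute
with the Bochner integral. -/
theorem integral_ctrl_eq_embed (ω : ℕ → ℝ) (b : EllTwo) {T : ℝ} {u : ℝ → ℝ} (hu : IsControl T u)
    {t : ℝ} (ht : t ∈ Icc 0 T) {m : EllTwoC} (hm : ∀ k, m k = moments ω u 0 t k) :
    ∫ s in (0 : ℝ)..t, u s • flow ω (t - s) (ctrl b) = embed b (rotate ω t m) := by
  have hui := hu.intervalIntegrable ⟨le_rfl, ht.1.trans ht.2⟩ ht
  have hint : IntervalIntegrable (fun s => u s • flow ω (t - s) (ctrl b)) volume 0 t :=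
    hui.smul_continuousOn
      ((continuous_flow ω (ctrl b)).comp (continuous_const.sub continuous_id)).continuousOn
  have hcos : ∀ k, IntervalIntegrable (fun s => Real.cos (ω k * s) * u s) volume 0 t := fun k =>
    hui.continuousOn_mul (by fun_prop)
  have hsin : ∀ k, IntervalIntegrable (fun s => -Real.sin (ω k * s) * u s) volume 0 t := fun k =>
    hui.continuousOn_mul (by fun_prop)
  refine state_ext fun k => ⟨?_, ?_⟩
  · have h := ((lp.evalCLM ℝ (fun _ : ℕ => ℝ) 2 k).comp
      (WithLp.fstL 2 ℝ EllTwo EllTwo)).intervalIntegral_comp_comm hint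
    refine h.symm.trans ?_
    rw [embed_fst, rotate_apply, hm, Complex.mul_im, Complex.exp_ofReal_mul_I_re,
      Complex.exp_ofReal_mul_I_im, moments]
    simp only
    rw [← intervalIntegral.integral_mul_const, ← intervalIntegral.integral_mul_const,
      ← intervalIntegral.integral_add ((hcos k).mul_const _) ((hsin k).mul_const _),
      ← intervalIntegral.integral_const_mul]
    refine intervalIntegral.integral_congr fun s _ => ?_
    change u s * (Real.cos (ω k * (t - s)) * 0 + Real.sin (ω k * (t - s)) * b k) = _
    rw [mul_sub, Real.sin_sub]
    ring
  · have h := ((lp.evalCLM ℝ (fun _ : ℕ => ℝ) 2 k).comp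
      (WithLp.sndL 2 ℝ EllTwo EllTwo)).intervalIntegral_comp_comm hint
    refine h.symm.trans ?_
    rw [embed_snd, rotate_apply, hm, Complex.mul_re, Complex.exp_ofReal_mul_I_re,
      Complex.exp_ofReal_mul_I_im, moments]
    simp only
    rw [← intervalIntegral.integral_mul_const, ← intervalIntegral.integral_mul_const,
      ← intervalIntegral.integral_sub ((hcos k).mul_const _) ((hsin k).mul_const _),
      ← intervalIntegral.integral_const_mul]
    refine intervalIntegral.integral_congr fun s _ => ?_
    change u s * (-Real.sin (ω k * (t - s)) * 0 + Real.cos (ω k * (t - s)) * b k) = _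
    rw [mul_sub, Real.cos_sub]
    ring

theorem solution_embed (ω : ℕ → ℝ) (b : EllTwo) {T : ℝ} {u : ℝ → ℝ} (hu : IsControl T u)
    {t : ℝ} (ht : t ∈ Icc 0 T) {m : EllTwoC} (hm : ∀ k, m k = moments ω u 0 t k) (y : EllTwoC) :
    solution ω b (embed b y) u t = embed b (rotate ω t (y + m)) := by
  have h : rotate ω t (y + m) = rotate ω t y + rotate ω t m :=
    lp.ext (funext fun k => add_mul (y k) (m k) _)
  rw [solution, flow_embed, integral_ctrl_eq_embed ω b hu ht hm, h, map_add]

/-! ### Controllability, well-posedness and maximality. -/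

section Main

variable {ω : ℕ → ℝ} {γ T : ℝ} {b : EllTwo}

theorem exactlyControllableIn_V (hb : ∀ k, b k ≠ 0) (hγ : 0 < γ) (hω0 : 0 < ω 0)
    (hgap : ∀ k, γ ≤ ω (k + 1) - ω k) (hT : 2 * Real.pi / γ < T) :
    ExactlyControllableIn ω b T (V b) := by
  have hT0 : 0 ≤ T := le_trans (by have := Real.pi_pos; positivity) hT.le
  intro x₀ hx₀ x₁ hx₁
  rw [← SetLike.mem_coe, ← range_embed hb] at hx₀ hx₁
  obtain ⟨y₀, rfl⟩ := hx₀
  obtain ⟨y₁, rfl⟩ := hx₁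
  -- Solving `e^{i ωₖ T} (y₀ + m) = y₁` for `m` prescribes these moments.
  obtain ⟨u, hu, hm⟩ := exists_control_moments_eq hγ hω0 hgap hT (rotate ω (-T) y₁ - y₀)
  refine ⟨u, hu, ?_⟩
  rw [solution_embed ω b hu ⟨hT0, le_rfl⟩ (fun k => (hm k).symm), add_sub_cancel,
    rotate_rotate_neg]

theorem moments_sub {u : ℝ → ℝ} (hu : IsControl T u) {s t : ℝ} (hs : s ∈ Icc 0 T)
    (ht : t ∈ Icc 0 T) (k : ℕ) :
    moments ω u 0 t k - moments ω u 0 s k = moments ω u s t k := by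
  have h0 : (0 : ℝ) ∈ Icc 0 T := ⟨le_rfl, hs.1.trans hs.2⟩
  have hc : ∀ x ∈ Icc 0 T, IntervalIntegrable (fun s => Real.cos (ω k * s) * u s) volume 0 x :=
    fun x hx => (hu.intervalIntegrable h0 hx).continuousOn_mul (by fun_prop)
  have hsn : ∀ x ∈ Icc 0 T, IntervalIntegrable (fun s => -Real.sin (ω k * s) * u s) volume 0 x :=
    fun x hx => (hu.intervalIntegrable h0 hx).continuousOn_mul (by fun_prop)
  exact Complex.ext (intervalIntegral.integral_interval_sub_left (hc t ht) (hc s hs))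
    (intervalIntegral.integral_interval_sub_left (hsn t ht) (hsn s hs))

theorem wellPosedInV (hb : ∀ k, b k ≠ 0) (hγ : 0 < γ) (hω0 : 0 < ω 0)
    (hgap : ∀ k, γ ≤ ω (k + 1) - ω k) : WellPosedInV ω b := by
  intro τ hτ
  obtain ⟨C, hC0, hC⟩ := exists_sum_moments_le hγ hω0 hgap hτ.le
  refine ⟨1 + Real.sqrt C, fun x₀ hx₀ u hu => ?_⟩
  rw [← SetLike.mem_coe, ← range_embed hb] at hx₀
  obtain ⟨y, rfl⟩ := hx₀
  have hm : ∀ t : Icc 0 τ, ∃ m : EllTwoC, ∀ k, m k = moments ω u 0 t k := fun t =>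
    ⟨⟨_, memℓp_of_sum_range_le (hC u hu 0 t le_rfl t.2.1 t.2.2)⟩, fun _ => rfl⟩
  choose m hm using hm
  have hsol : ∀ t : Icc 0 τ, solution ω b (embed b y) u t = embed b (rotate ω t (y + m t)) :=
    fun t => solution_embed ω b hu t.2 (hm t) y
  have hsq : IntegrableOn (fun s => u s ^ 2) (Ioc 0 τ) := hu.integrable_sq
  have hdiff : ∀ s t : Icc 0 τ, s ≤ t →
      ‖m t - m s‖ ^ 2 ≤ C * ∫ r in (s : ℝ)..t, u r ^ 2 := by
    intro s t hst
    refine norm_sq_le_of_sum_range_le fun N => ?_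
    have h : ∀ k, (m t - m s) k = moments ω u s t k := fun k => by
      rw [← moments_sub hu s.2 t.2, ← hm, ← hm]; rfl
    simp only [h]
    exact hC u hu s t s.2.1 hst t.2.2 N
  have hsqi : ∀ t : Icc 0 τ, IntervalIntegrable (fun s => u s ^ 2) volume 0 t := fun t =>
    (intervalIntegrable_iff_integrableOn_Ioc_of_le t.2.1).2
      (hsq.mono_set (Ioc_subset_Ioc_right t.2.2))
  -- The energy spent up to time `t`; its continuity controls the increments of the moments.
  let G : ℝ → ℝ := fun t => ∫ r in (0 : ℝ)..t, u r ^ 2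
  have hdiff' : ∀ s t : Icc 0 τ, ‖m s - m t‖ ≤ Real.sqrt (C * |G s - G t|) := by
    intro s t
    refine Real.le_sqrt_of_sq_le ?_
    rcases le_total s t with h | h
    · rw [norm_sub_rev, abs_sub_comm]
      refine (hdiff s t h).trans ?_
      rw [← intervalIntegral.integral_interval_sub_left (hsqi t) (hsqi s)]
      gcongr
      exact le_abs_self _
    · refine (hdiff t s h).trans ?_
      rw [← intervalIntegral.integral_interval_sub_left (hsqi s) (hsqi t)]
      gcongr
      exact le_abs_self _
  have hG : ContinuousOn G (Icc 0 τ) := by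
    have := intervalIntegral.continuousOn_primitive_interval (f := fun r => u r ^ 2)
      (μ := volume) (a := 0) (b := τ)
      (by rwa [uIcc_of_le hτ.le, integrableOn_Icc_iff_integrableOn_Ioc])
    rwa [uIcc_of_le hτ.le] at this
  refine ⟨fun t ht => ?_, fun t ht => ?_, fun t ht => ?_⟩
  · rw [← SetLike.mem_coe, ← range_embed hb]
    exact ⟨_, (hsol ⟨t, ht⟩).symm⟩
  · have hbound : Tendsto (fun s => Real.sqrt (C * |G s - G t|) +
        ‖rotate ω s (y + m ⟨t, ht⟩) - rotate ω t (y + m ⟨t, ht⟩)‖) (𝓝[Icc 0 τ] t) (𝓝 0) := by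
      have h1 : Tendsto (fun s => Real.sqrt (C * |G s - G t|)) (𝓝[Icc 0 τ] t)
          (𝓝 (Real.sqrt (C * |G t - G t|))) :=
        (((hG t ht).tendsto.sub_const (G t)).abs.const_mul C).sqrt
      have h2 : Tendsto (fun s => ‖rotate ω s (y + m ⟨t, ht⟩) - rotate ω t (y + m ⟨t, ht⟩)‖)
          (𝓝[Icc 0 τ] t) (𝓝 0) :=
        (tendsto_iff_norm_sub_tendsto_zero.1
          ((continuous_rotate ω (y + m ⟨t, ht⟩)).tendsto t)).mono_left nhdsWithin_le_nhds
      simpa using h1.add h2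
    refine squeeze_zero' (Eventually.of_forall fun s => Real.sqrt_nonneg _) ?_ hbound
    filter_upwards [self_mem_nhdsWithin] with s hs
    rw [hsol ⟨s, hs⟩, hsol ⟨t, ht⟩, ← map_sub, vNorm_embed hb]
    -- The increment splits into a rotated moment increment, whose norm the rotation preserves, and
    -- the motion of a fixed vector under the strongly continuous group.
    have h : rotate ω s (y + m ⟨s, hs⟩) - rotate ω t (y + m ⟨t, ht⟩) =
        rotate ω s (m ⟨s, hs⟩ - m ⟨t, ht⟩) +
          (rotate ω s (y + m ⟨t, ht⟩) - rotate ω t (y + m ⟨t, ht⟩)) := by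
      rw [show m ⟨s, hs⟩ - m ⟨t, ht⟩ = (y + m ⟨s, hs⟩) - (y + m ⟨t, ht⟩) by abel, rotate_sub]
      abel
    change ‖rotate ω s (y + m ⟨s, hs⟩) - rotate ω t (y + m ⟨t, ht⟩)‖ ≤ _
    rw [h]
    refine (norm_add_le _ _).trans ?_
    rw [norm_rotate]
    gcongr
    exact hdiff' ⟨s, hs⟩ ⟨t, ht⟩
  · rw [hsol ⟨t, ht⟩, vNorm_embed hb, vNorm_embed hb, norm_rotate]
    have h1 : ‖m ⟨t, ht⟩‖ ≤ Real.sqrt C * Real.sqrt (∫ s in (0 : ℝ)..τ, u s ^ 2) := by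
      rw [← Real.sqrt_mul hC0]
      refine Real.le_sqrt_of_sq_le ?_
      refine (norm_sq_le_of_sum_range_le fun N => ?_).trans
        (mul_le_mul_of_nonneg_left (intervalIntegral.integral_mono_interval (c := 0) (d := τ)
          (a := 0) (b := t) le_rfl ht.1 ht.2 (Eventually.of_forall fun _ => sq_nonneg _)
          (hsqi ⟨τ, hτ.le, le_rfl⟩)) hC0)
      simp only [hm]
      exact hC u hu 0 t le_rfl ht.1 ht.2 N
    have h2 := norm_add_le y (m ⟨t, ht⟩)
    have h3 := Real.sqrt_nonneg (∫ s in (0 : ℝ)..τ, u s ^ 2)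
    have h4 := mul_nonneg (Real.sqrt_nonneg C) (norm_nonneg y)
    linarith

theorem reachable_subset_V (hT : 0 < T) (hwp : WellPosedInV ω b) {x₀ : State} (hx₀ : x₀ ∈ V b) :
    reachable ω b T x₀ ⊆ (V b : Set State) := by
  rintro x ⟨u, hu, rfl⟩
  obtain ⟨C, hC⟩ := hwp T hT
  exact (hC x₀ hx₀ u hu).1 T ⟨hT.le, le_rfl⟩

end Main

end Oscillator

theorem mainTheorem5 (b : Oscillator.EllTwo) (ω : ℕ → ℝ) (ωstar T : ℝ)
    (hb : ∀ k, b k ≠ 0)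
    (hω₀ : 0 < ω 0) (hωstar : 0 < ωstar) (hgap : ∀ k, ωstar ≤ ω (k + 1) - ω k)
    (hT : 2 * Real.pi / ωstar < T) :
    Oscillator.IsHilbertSubspaceWith (Oscillator.V b) (Oscillator.vInner b) ∧
    Oscillator.ExactlyControllableIn ω b T (Oscillator.V b) ∧
    (∀ x₀ ∈ Oscillator.V b, Oscillator.reachable ω b T x₀ = (Oscillator.V b : Set Oscillator.State)) ∧
    IsGreatest {W : Submodule ℝ Oscillator.State |
      Oscillator.IsHilbertSubspace W ∧ Oscillator.ExactlyControllableIn ω b T W}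
      (Oscillator.V b) ∧
    Oscillator.WellPosedInV ω b := by
  have hT0 : 0 < T := lt_trans (by have := Real.pi_pos; positivity) hT
  have hH := Oscillator.isHilbertSubspaceWith_V hb
  have hE := Oscillator.exactlyControllableIn_V hb hωstar hω₀ hgap hT
  have hwp := Oscillator.wellPosedInV hb hωstar hω₀ hgap
  refine ⟨hH, hE, fun x₀ hx₀ => ?_, ⟨⟨⟨_, hH⟩, hE⟩, ?_⟩, hwp⟩
  · exact (Oscillator.reachable_subset_V hT0 hwp hx₀).antisymm fun x hx => hE x₀ hx₀ x hx
  -- As `0 ∈ W`, each `x ∈ W` is reachable from `0`, and `0` also lies in `V b`.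
  · rintro W ⟨-, hW⟩ x hx
    exact Oscillator.reachable_subset_V hT0 hwp (Oscillator.V b).zero_mem
      (hW 0 W.zero_mem x hx)
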